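/- Let $k$ be an algebraically closed field; a variety over $k$ is an integral separated scheme of finite type over $k$. For a variety $X$ over $k$ and $m\ge 0$ let $X_m$ be the $m$-th jet scheme of $X$, regarded as the set of its $k$-valued points, that is, of the $k$-morphisms $\operatorname{Spec} k[t]/(t^{m+1})\to X$, with the Zariski topology. Let $X_\infty=\varprojlim_m X_m$ be the arc space (again its $k$-valued points), with projections $\psi_m: X_\infty\to X_m$ and $\pi=\psi_0: X_\infty\to X_0=X$. For a closed point $x\in X$ put $$\lambda_m(x)=m\dim X-\dim \psi_m(\pi^{-1}(x)),$$ where the dimension of a subset of $X_m$ is the dimension of its Zariski closure, and let $\lambda(x)=\lim_{m\to\infty}\lambda_m(x)$. Let $X$ and $Y$ be varieties over $k$ with $Y$ smooth over $k$, let $x\in X$ and $y\in Y$ be closed points, and let $(x,y)$ be the corresponding closed point of $X\times_k Y$. Then $$\lambda((x,y))=\lambda(x).$$ More precisely, for every integer $L$, the sequence $\lambda_m((x,y))$ converges to $L$ if and only if the sequence $\lambda_m(x)$ converges to $L$. -/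

import Mathlib

open CategoryTheory CategoryTheory.Limits AlgebraicGeometry Filter Topology

universe u

namespace JetArc

/-- A variety over `k`, given by its structure morphism: an integral, separated scheme of finite
type over `k`. -/
class IsVariety {k : Type u} [Field k] {X : Scheme.{u}} (p : X ⟶ Spec (CommRingCat.of k)) :
    Prop where
  isIntegral : IsIntegral X
  isSeparated : IsSeparated p
  locallyOfFiniteType : LocallyOfFiniteType p
  quasiCompact : QuasiCompact p

/-- The ring `k[t]/(t^(m+1))`. -/
abbrev Trunc (k : Type u) [Field k] (m : ℕ) : Type u :=
  AdjoinRoot ((Polynomial.X : Polynomial k) ^ (m + 1))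

/-- The truncation `k[t]/(t^(m+1)) → k[t]/(t^(n+1))` for `n ≤ m`. -/
noncomputable def truncMap (k : Type u) [Field k] {n m : ℕ} (h : n ≤ m) :
    Trunc k m →ₐ[k] Trunc k n :=
  AdjoinRoot.algHomOfDvd k _ _ (pow_dvd_pow Polynomial.X (Nat.succ_le_succ h))

/-- The coefficient of `t^j` (`j ≤ m`) of an element of `k[t]/(t^(m+1))`: the coefficient of its
representative of degree at most `m`. -/
noncomputable def truncCoeff (k : Type u) [Field k] {m : ℕ} (j : Fin (m + 1)) (a : Trunc k m) : k :=
  (AdjoinRoot.modByMonicHom (Polynomial.monic_X_pow (R := k) (m + 1)) a).coeff j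

section

variable {k : Type u} [Field k] {X : Scheme.{u}} (p : X ⟶ Spec (CommRingCat.of k))

/-- The `k`-valued points of the `m`-th jet scheme of `X`: the `k`-morphisms
`Spec k[t]/(t^(m+1)) ⟶ X`. -/
@[ext]
structure Jet (m : ℕ) where
  /-- the underlying morphism of schemes -/
  hom : Spec (CommRingCat.of (Trunc k m)) ⟶ X
  w : hom ≫ p = Spec.map (CommRingCat.ofHom (algebraMap k (Trunc k m)))

variable {p}

/-- The canonical projection `X_m → X_n` for `n ≤ m`. -/
noncomputable def Jet.trunc {n m : ℕ} (h : n ≤ m) (γ : Jet p m) : Jet p n where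
  hom := Spec.map (CommRingCat.ofHom (truncMap k h).toRingHom) ≫ γ.hom
  w := by
    rw [Category.assoc, γ.w, ← Spec.map_comp, ← CommRingCat.ofHom_comp]
    congr 2
    exact (truncMap k h).comp_algebraMap

/-- The jet `γ` factors through the open subscheme `U`. -/
def Jet.LiesIn {m : ℕ} (γ : Jet p m) (U : X.Opens) : Prop :=
  (⊤ : (Spec (CommRingCat.of (Trunc k m))).Opens) ≤ γ.hom ⁻¹ᵁ U

/-- The pullback `γ^* : 𝒪(U) → k[t]/(t^(m+1))` along a jet which factors through `U`. -/
noncomputable def Jet.pullbackFun {m : ℕ} (γ : Jet p m) {U : X.Opens} (h : γ.LiesIn U) :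
    Γ(X, U) →+* Trunc k m :=
  (γ.hom.appLE U ⊤ h ≫ (Scheme.ΓSpecIso (CommRingCat.of (Trunc k m))).hom).hom

/-- For an open `U` and a polynomial `F` with coefficients in `k` in the variables `a^(j)`
(`a ∈ 𝒪(U)`, `0 ≤ j ≤ m`), the set of the jets `γ` in `U` at which `F` does not vanish when
`a^(j)` is given as value the coefficient of `t^j` in `γ^* a`. -/
def Jet.basicOpen (p : X ⟶ Spec (CommRingCat.of k)) (m : ℕ) (U : X.Opens)
    (F : MvPolynomial (Γ(X, U) × Fin (m + 1)) k) : Set (Jet p m) :=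
  {γ | ∃ h : γ.LiesIn U,
    MvPolynomial.eval (fun q ↦ truncCoeff k q.2 (γ.pullbackFun h q.1)) F ≠ 0}

/-- The Zariski topology on the `k`-valued points of the jet scheme `X_m`. For `U` affine open in
`X`, the jet scheme `U_m` is an affine open subscheme of `X_m`, and its coordinate ring is generated
over `k` by the coordinates `a^(j)`, `a ∈ 𝒪(U)`, `0 ≤ j ≤ m`; so the sets below are the principal
open subsets of the members `U_m` of an affine open cover of `X_m`. -/
instance (m : ℕ) : TopologicalSpace (Jet p m) :=
  TopologicalSpace.generateFrom
    {V | ∃ (U : X.Opens) (F : MvPolynomial (Γ(X, U) × Fin (m + 1)) k),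
      IsAffineOpen U ∧ V = Jet.basicOpen p m U F}

variable (p)

/-- The `k`-valued points of the arc space `X_∞`: the projective limit of the sets of jets. -/
structure Arc where
  /-- the `m`-jet of the arc -/
  jet : ∀ m : ℕ, Jet p m
  compat : ∀ (n m : ℕ) (h : n ≤ m), (jet m).trunc h = jet n

/-- The fibre `π⁻¹(x) ⊆ X_∞` of `π = ψ_0 : X_∞ → X_0 = X` over `x`. A `0`-jet is identified with
the image of the only point of `Spec k[t]/(t)`. -/
def arcFiber (x : X) : Set (Arc p) :=
  {γ | ∀ s : Spec (CommRingCat.of (Trunc k 0)), (γ.jet 0).hom s = x}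

/-- The set `ψ_m(π⁻¹(x)) ⊆ X_m`. -/
def jetImage (x : X) (m : ℕ) : Set (Jet p m) :=
  (fun γ : Arc p ↦ γ.jet m) '' arcFiber p x

end

/-- The dimension of a nonempty space of finite Krull dimension, as a natural number. -/
noncomputable def dim (T : Type*) [TopologicalSpace T] : ℕ :=
  ((topologicalKrullDim T).unbotD 0).toNat

section

variable {k : Type u} [Field k] {X : Scheme.{u}} (p : X ⟶ Spec (CommRingCat.of k))

/-- `λ_m(x) = m · dim X - dim ψ_m(π⁻¹(x))`. The dimension of a (constructible) subset of `X_m` is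
the dimension of its Zariski closure. -/
noncomputable def lambdaSeq (x : X) (m : ℕ) : ℤ :=
  (m : ℤ) * (dim X : ℤ) - (dim (closure (jetImage p x m)) : ℤ)

/-- `λ(x) = L`, in the sense that `λ_m(x)` converges to `L`, that is, `λ_m(x) = L` for all large
enough `m`. -/
def HasLambda (x : X) (L : ℤ) : Prop :=
  Tendsto (lambdaSeq p x) atTop (𝓝 L)

/-- The invariant `λ(x) = lim_{m → ∞} λ_m(x)`. -/
noncomputable def lambda (x : X) : ℤ :=
  limUnder atTop (lambdaSeq p x)

end

end JetArc

/-!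
Let `S` be a set of `m`-jets centred at a closed point `x`, and let `U` be any affine neighbourhood
of `x`. The dimension of the Zariski closure of `S` is the Krull dimension of the algebra of
`k`-valued functions on `S` generated by the coordinates `a^(j)`, for `a ∈ Γ(X, U)` and `j ≤ m`.
For the jets at `(x, y)` that lift to arcs, this algebra is the tensor product of the algebras for
`x` and `y`, so `λ_m` is additive on products. At a smooth point `y` of `Y`, étale coordinates
`Y → 𝔸ⁿ` identify the arcs at `y` with arbitrary `n`-tuples of power series without constant term;
the algebra is then a polynomial ring in `n * m` variables, and `λ_m(y) = 0`.
-/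

namespace JetArc

open TensorProduct TopologicalSpace

section KrullDimension

theorem exists_ltSeries_comap_last_eq {R S : Type*} [CommRing R] [CommRing S] [Algebra R S]
    [Algebra.IsIntegral R S] [FaithfulSMul R S] (l : LTSeries (PrimeSpectrum R)) :
    ∃ l' : LTSeries (PrimeSpectrum S), l'.length = l.length ∧
      l'.last.comap (algebraMap R S) = l.last := by
  induction l using RelSeries.inductionOn' with
  | singleton p =>
    obtain ⟨Q, -, hQ, hp⟩ := Ideal.exists_ideal_over_prime_of_isIntegral (S := S) p.asIdeal ⊥
      (by simp [Ideal.comap_bot_of_injective _ (FaithfulSMul.algebraMap_injective R S)])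
    exact ⟨RelSeries.singleton _ ⟨Q, hQ⟩, rfl, PrimeSpectrum.ext hp⟩
  | snoc l p hlp ih =>
    obtain ⟨l', hl', hlast⟩ := ih
    have hlp' : l'.last.comap (algebraMap R S) < p := hlast ▸ hlp
    obtain ⟨Q, hQle, hQ, hp⟩ := Ideal.exists_ideal_over_prime_of_isIntegral (S := S) p.asIdeal
      l'.last.asIdeal hlp'.le
    have hlt : l'.last < ⟨Q, hQ⟩ :=
      lt_of_le_of_ne hQle fun h ↦ hlp'.ne (h ▸ PrimeSpectrum.ext hp)
    exact ⟨l'.snoc ⟨Q, hQ⟩ hlt, by simp [hl'], by simpa using PrimeSpectrum.ext hp⟩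

theorem ringKrullDim_eq_of_injective_of_isIntegral {R S : Type*} [CommRing R] [CommRing S]
    (f : R →+* S) (hinj : Function.Injective f) (hint : f.IsIntegral) :
    ringKrullDim S = ringKrullDim R := by
  algebraize [f]
  have : FaithfulSMul R S := (faithfulSMul_iff_algebraMap_injective R S).mpr hinj
  refine le_antisymm ?_ (iSup_le fun l ↦ ?_)
  · refine Order.krullDim_le_of_strictMono (fun p ↦ p.comap (algebraMap R S)) fun p q hpq ↦ ?_
    exact Ideal.IsIntegral.comap_lt_comap (R := R) (I := p.asIdeal) (J := q.asIdeal) hpq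
  · obtain ⟨l', hl', -⟩ := exists_ltSeries_comap_last_eq (S := S) l
    rw [← hl']
    exact Order.LTSeries.length_le_krullDim l'

theorem ringKrullDim_mvPolynomial_field (k : Type*) [Field k] (ι : Type*) [Finite ι] :
    ringKrullDim (MvPolynomial ι k) = Nat.card ι := by
  simp [MvPolynomial.ringKrullDim_of_isNoetherianRing, ringKrullDim_eq_zero_of_field]

theorem exists_ringKrullDim_eq_natCast (k : Type*) [Field k] (R : Type*) [CommRing R]
    [Nontrivial R] [Algebra k R] [Algebra.FiniteType k R] : ∃ d : ℕ, ringKrullDim R = d := by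
  obtain ⟨s, g, hinj, hint⟩ := exists_integral_inj_algHom_of_fg k R
  refine ⟨s, ?_⟩
  rw [ringKrullDim_eq_of_injective_of_isIntegral g.toRingHom hinj hint,
    ringKrullDim_mvPolynomial_field, Nat.card_fin]

theorem isIntegral_tensorProductMap_id {k A B : Type*} (S : Type*) [CommRing k] [CommRing A]
    [CommRing B] [CommRing S] [Algebra k A] [Algebra k B] [Algebra k S] (f : A →ₐ[k] B)
    (hf : f.toRingHom.IsIntegral) :
    (Algebra.TensorProduct.map (AlgHom.id S S) f).toRingHom.IsIntegral := by
  algebraize [f.toRingHom, (Algebra.TensorProduct.map (AlgHom.id S S) f).toRingHom]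
  intro x
  change IsIntegral (S ⊗[k] A) x
  induction x with
  | zero => exact isIntegral_zero
  | add x y hx hy => exact hx.add hy
  | tmul s b =>
    have hs : IsIntegral (S ⊗[k] A) (s ⊗ₜ[k] (1 : B)) := by
      simpa [RingHom.algebraMap_toAlgebra] using
        isIntegral_algebraMap (R := S ⊗[k] A) (A := S ⊗[k] B) (x := s ⊗ₜ[k] 1)
    have hb : IsIntegral (S ⊗[k] A) ((1 : S) ⊗ₜ[k] b) :=
      (show IsIntegral A b from hf b).map_of_comp_eq
        (Algebra.TensorProduct.includeRight (R := k) (A := S) (B := A)).toRingHom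
        (Algebra.TensorProduct.includeRight (R := k) (A := S) (B := B)).toRingHom
        (by ext; simp [RingHom.algebraMap_toAlgebra])
    simpa using hs.mul hb

theorem ringKrullDim_tensorProduct (k : Type*) [Field k] (R S : Type*) [CommRing R] [Algebra k R]
    [Algebra.FiniteType k R] [CommRing S] [Algebra k S] [Algebra.FiniteType k S] :
    ringKrullDim (S ⊗[k] R) = ringKrullDim S + ringKrullDim R := by
  cases subsingleton_or_nontrivial R
  · have : Subsingleton (S ⊗[k] R) := (Algebra.TensorProduct.includeRight (R := k) (A := S)
      (B := R)).toRingHom.codomain_trivial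
    simp [ringKrullDim_eq_bot_of_subsingleton]
  obtain ⟨s, g, hinj, hint⟩ := exists_integral_inj_algHom_of_fg k R
  let g' : S ⊗[k] MvPolynomial (Fin s) k →ₐ[S] S ⊗[k] R := Algebra.TensorProduct.map (.id S S) g
  have hinj' : Function.Injective g' :=
    Module.Flat.lTensor_preserves_injective_linearMap (M := S) g.toLinearMap hinj
  have : IsNoetherianRing S := Algebra.FiniteType.isNoetherianRing k S
  rw [ringKrullDim_eq_of_injective_of_isIntegral g'.toRingHom hinj'
    (isIntegral_tensorProductMap_id S g hint),
    ringKrullDim_eq_of_injective_of_isIntegral g.toRingHom hinj hint,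
    ringKrullDim_eq_of_ringEquiv (MvPolynomial.algebraTensorAlgEquiv k S).toRingEquiv,
    MvPolynomial.ringKrullDim_of_isNoetherianRing, ringKrullDim_mvPolynomial_field]

theorem trdeg_eq_of_isAlgebraic (k : Type*) [Field k] (R S : Type u) [CommRing R] [IsDomain R]
    [CommRing S] [IsDomain S] [Algebra k R] [Algebra k S] [Algebra R S]
    [IsScalarTower k R S] [FaithfulSMul R S] [Algebra.IsAlgebraic R S] :
    Algebra.trdeg k S = Algebra.trdeg k R := by
  rw [← trdeg_add_eq k R (A := S), trdeg_eq_zero (R := R), add_zero]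

theorem ringKrullDim_eq_toNat_trdeg {k : Type u} [Field k] (R : Type u) [CommRing R] [IsDomain R]
    [Algebra k R] [Algebra.FiniteType k R] :
    ringKrullDim R = (Algebra.trdeg k R).toNat := by
  obtain ⟨s, g, hinj, hint⟩ := exists_integral_inj_algHom_of_fg k R
  rw [ringKrullDim_eq_of_injective_of_isIntegral g.toRingHom hinj hint,
    ringKrullDim_mvPolynomial_field, Nat.card_fin]
  algebraize [g.toRingHom]
  have : FaithfulSMul (MvPolynomial (Fin s) k) R :=
    (faithfulSMul_iff_algebraMap_injective _ _).mpr hinj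
  have : IsScalarTower k (MvPolynomial (Fin s) k) R := .of_algebraMap_eq' g.comp_algebraMap.symm
  rw [trdeg_eq_of_isAlgebraic k (MvPolynomial (Fin s) k) R]
  simp

theorem isAlgebraic_of_etale (P B : Type*) [CommRing P] [IsDomain P] [CommRing B] [Algebra P B]
    [Algebra.Etale P B] : Algebra.IsAlgebraic P B := by
  refine ⟨fun b ↦ ?_⟩
  let K := FractionRing P
  have : Module.Finite K (K ⊗[P] B) := Algebra.FormallyUnramified.finite_of_free K _
  have hinj : Function.Injective (Algebra.TensorProduct.includeRight : B →ₐ[P] K ⊗[P] B) :=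
    Algebra.TensorProduct.includeRight_injective (IsFractionRing.injective P K)
  rw [← isAlgebraic_algHom_iff _ hinj, IsFractionRing.isAlgebraic_iff P K (K ⊗[P] B)]
  exact (Algebra.IsIntegral.isIntegral _).isAlgebraic

theorem trdeg_of_etale_mvPolynomial {k : Type u} [Field k] {B : Type u} [CommRing B] [IsDomain B]
    [Algebra k B] (n : ℕ) [Algebra (MvPolynomial (Fin n) k) B]
    [IsScalarTower k (MvPolynomial (Fin n) k) B] [Algebra.Etale (MvPolynomial (Fin n) k) B] :
    Algebra.trdeg k B = n := by
  have := isAlgebraic_of_etale (MvPolynomial (Fin n) k) B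
  rw [trdeg_eq_of_isAlgebraic k (MvPolynomial (Fin n) k) B]
  simp

end KrullDimension

section Topology

theorem isIrreducible_preimage_of_closure_image_preimage_eq {T X : Type*} [TopologicalSpace T]
    [TopologicalSpace X] {f : T → X} (hf : IsInducing f) {Z : Set X} (hZ : IsIrreducible Z)
    (hcl : closure (f '' (f ⁻¹' Z)) = Z) : IsIrreducible (f ⁻¹' Z) := by
  have himage : IsIrreducible (f '' (f ⁻¹' Z)) := by rwa [← isIrreducible_iff_closure, hcl]
  refine ⟨Set.image_nonempty.mp himage.1, fun u v hu hv ⟨a, ha, hau⟩ ⟨b, hb, hbv⟩ ↦ ?_⟩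
  obtain ⟨u', hu', rfl⟩ := hf.isOpen_iff.mp hu
  obtain ⟨v', hv', rfl⟩ := hf.isOpen_iff.mp hv
  obtain ⟨_, ⟨c, hc, rfl⟩, hcu, hcv⟩ := himage.2 u' v' hu' hv' ⟨f a, ⟨a, ha, rfl⟩, hau⟩
    ⟨f b, ⟨b, hb, rfl⟩, hbv⟩
  exact ⟨c, hc, hcu, hcv⟩

theorem topologicalKrullDim_eq_of_isInducing {T X : Type*} [TopologicalSpace T]
    [TopologicalSpace X] {f : T → X} (hf : IsInducing f)
    (h : ∀ Z : Set X, IsClosed Z → Z ⊆ closure (f '' (f ⁻¹' Z))) :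
    topologicalKrullDim T = topologicalKrullDim X := by
  have hcl (Z : IrreducibleCloseds X) : closure (f '' (f ⁻¹' (Z : Set X))) = Z :=
    (closure_minimal (Set.image_preimage_subset f Z) Z.isClosed).antisymm (h Z Z.isClosed)
  let preimage (Z : IrreducibleCloseds X) : IrreducibleCloseds T :=
    ⟨f ⁻¹' (Z : Set X), isIrreducible_preimage_of_closure_image_preimage_eq hf Z.isIrreducible
      (hcl Z), Z.isClosed.preimage hf.continuous⟩
  have hmono : Monotone preimage := fun Z Z' hZ ↦
    Set.preimage_mono (f := f) (SetLike.coe_subset_coe.mpr hZ)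
  have hinj : Function.Injective preimage := fun Z Z' hZ ↦ by
    have hZ' : f ⁻¹' (Z : Set X) = f ⁻¹' (Z' : Set X) := congrArg IrreducibleCloseds.carrier hZ
    exact SetLike.coe_injective (by rw [← hcl Z, hZ', hcl Z'])
  exact hf.topologicalKrullDim_le.antisymm
    (Order.krullDim_le_of_strictMono preimage (hmono.strictMono_of_injective hinj))

theorem topologicalKrullDim_nonneg_iff {X : Type*} [TopologicalSpace X] :
    0 ≤ topologicalKrullDim X ↔ Nonempty X := by
  rw [topologicalKrullDim, Order.krullDim_nonneg_iff]
  refine ⟨fun ⟨Z⟩ ↦ Z.isIrreducible.nonempty.to_type, fun ⟨x⟩ ↦ ?_⟩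
  exact ⟨⟨closure {x}, isIrreducible_singleton.closure, isClosed_closure⟩⟩

theorem topologicalKrullDim_eq_iSup_of_iSup_eq_top {X : Type*} [TopologicalSpace X] {ι : Type*}
    {U : ι → Opens X} (hU : ⨆ i, U i = ⊤) :
    topologicalKrullDim X = ⨆ i, topologicalKrullDim (U i) := by
  refine le_antisymm ?_ (iSup_le fun i ↦ topologicalKrullDim_subspace_le X (U i))
  rw [topologicalKrullDim, Order.krullDim_eq_iSup_coheight]
  refine iSup_le fun Z ↦ ?_
  obtain ⟨x, hx⟩ := Z.isIrreducible.nonempty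
  obtain ⟨i, hxi⟩ := Opens.mem_iSup.mp (hU ▸ Opens.mem_top x)
  have hemb := (U i).2.isOpenEmbedding_subtypeVal
  obtain ⟨W, hW⟩ := (IrreducibleCloseds.orderIsoOfIsOpenEmbedding _ hemb).surjective
    ⟨Z, ⟨⟨x, hxi⟩, hx⟩⟩
  have hZ : IrreducibleCloseds.map _ hemb.continuous W = Z := congrArg Subtype.val hW
  rw [← hZ, hemb.coheight_map]
  exact (Order.coheight_le_krullDim W).trans
    (le_iSup (fun i ↦ topologicalKrullDim (U i)) i)

end Topology

section Scheme

variable {k : Type u} [Field k] {X Y : Scheme.{u}} (p : X ⟶ Spec (CommRingCat.of k))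
  (q : Y ⟶ Spec (CommRingCat.of k))

/-- The ring `𝒪(U)` as a `k`-algebra; a type synonym of `Γ(X, U)` which remembers the structure
morphism `p`, so that the algebra structure can be an instance. -/
def Sections (_p : X ⟶ Spec (CommRingCat.of k)) (U : X.Opens) : Type u := Γ(X, U)

instance (U : X.Opens) : CommRing (Sections p U) := inferInstanceAs (CommRing Γ(X, U))

instance (U : X.Opens) [Nonempty U] : Nontrivial (Sections p U) :=
  inferInstanceAs (Nontrivial Γ(X, U))

instance (U : X.Opens) [Nonempty U] [IsIntegral X] : IsDomain (Sections p U) :=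
  inferInstanceAs (IsDomain Γ(X, U))

theorem le_preimage_top {Z : Scheme.{u}} (f : X ⟶ Z) (U : X.Opens) : U ≤ f ⁻¹ᵁ ⊤ :=
  fun _ _ ↦ trivial

/-- The structure morphism `k → 𝒪(U)`, as a morphism of rings. -/
noncomputable def sectionsBase (U : X.Opens) : CommRingCat.of k ⟶ Γ(X, U) :=
  (Scheme.ΓSpecIso (CommRingCat.of k)).inv ≫ p.appLE ⊤ U (le_preimage_top p U)

noncomputable instance (U : X.Opens) : Algebra k (Sections p U) :=
  RingHom.toAlgebra (S := Sections p U) (sectionsBase p U).hom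

theorem sectionsBase_map {U V : X.Opens} (h : U ≤ V) :
    sectionsBase p V ≫ X.presheaf.map (homOfLE h).op = sectionsBase p U := by
  rw [sectionsBase, Category.assoc, Scheme.Hom.appLE_map, sectionsBase]

theorem finiteType_sections [LocallyOfFiniteType p] {U : X.Opens} (hU : IsAffineOpen U) :
    Algebra.FiniteType k (Sections p U) := by
  have hp := p.finiteType_appLE (isAffineOpen_top _) hU (le_preimage_top p U)
  have hbase : (sectionsBase p U).hom.FiniteType := by
    rw [sectionsBase, CommRingCat.hom_comp]
    exact hp.comp (RingHom.FiniteType.of_surjective _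
      (ConcreteCategory.bijective_of_isIso (Scheme.ΓSpecIso (CommRingCat.of k)).inv).2)
  exact hbase

theorem isPushout_sectionsBase {U : X.Opens} {V : Y.Opens} (hU : IsAffineOpen U)
    (hV : IsAffineOpen V) :
    IsPushout (sectionsBase p U) (sectionsBase q V)
      ((pullback.fst p q).appLE U (pullback.fst p q ⁻¹ᵁ U ⊓ pullback.snd p q ⁻¹ᵁ V) inf_le_left)
      ((pullback.snd p q).appLE V (pullback.fst p q ⁻¹ᵁ U ⊓ pullback.snd p q ⁻¹ᵁ V)
        inf_le_right) := by
  have hpull := IsPullback.of_hasPullback p q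
  have hiso := isIso_pushoutSection_of_isAffineOpen hpull (US := ⊤) (UT := V) (UX := U)
    (le_preimage_top _ _) (le_preimage_top _ _) rfl (isAffineOpen_top _) hV hU
  have hpush := (isIso_pushoutSection_iff hpull (le_preimage_top _ _) (le_preimage_top _ _)
    rfl).mp hiso
  exact IsPushout.of_iso hpush (Scheme.ΓSpecIso (CommRingCat.of k)) (Iso.refl _) (Iso.refl _)
    (Iso.refl _) (by simp [sectionsBase]) (by simp [sectionsBase]) (by simp) (by simp)

theorem exists_sections_tensorProduct_ringEquiv {U : X.Opens} {V : Y.Opens} (hU : IsAffineOpen U)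
    (hV : IsAffineOpen V) :
    ∃ e : Sections p U ⊗[k] Sections q V ≃+*
        Γ(pullback p q, pullback.fst p q ⁻¹ᵁ U ⊓ pullback.snd p q ⁻¹ᵁ V),
      (∀ a, e (a ⊗ₜ 1) = (pullback.fst p q).appLE U _ inf_le_left a) ∧
      (∀ b, e (1 ⊗ₜ b) = (pullback.snd p q).appLE V _ inf_le_right b) := by
  have hpush := isPushout_sectionsBase p q hU hV
  have htensor := CommRingCat.isPushout_tensorProduct k (Sections p U) (Sections q V)
  refine ⟨(htensor.isoIsPushout _ _ hpush).commRingCatIsoToRingEquiv, fun a ↦ ?_, fun b ↦ ?_⟩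
  · exact congr($(htensor.inl_isoIsPushout_hom _ _ hpush) a)
  · exact congr($(htensor.inr_isoIsPushout_hom _ _ hpush) b)

theorem isAffineOpen_fst_inf_snd {U : X.Opens} {V : Y.Opens} (hU : IsAffineOpen U)
    (hV : IsAffineOpen V) :
    IsAffineOpen (pullback.fst p q ⁻¹ᵁ U ⊓ pullback.snd p q ⁻¹ᵁ V) := by
  have : IsAffine _ := hU
  have : IsAffine _ := hV
  have : IsAffine _ := isAffineOpen_top (Spec (CommRingCat.of k))
  exact .of_isIso (Scheme.Hom.isPullback_resLE (IsPullback.of_hasPullback p q)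
    (US := ⊤) (UT := V) (UX := U) (le_preimage_top _ _) (le_preimage_top _ _) rfl).isoPullback.hom

end Scheme

section Dimension

variable {k : Type u} [Field k] {X Y : Scheme.{u}}

theorem topologicalKrullDim_of_isAffineOpen {U : X.Opens} (hU : IsAffineOpen U) :
    topologicalKrullDim U = ringKrullDim Γ(X, U) := by
  rw [← PrimeSpectrum.topologicalKrullDim_eq_ringKrullDim]
  exact IsHomeomorph.topologicalKrullDim_eq _ (Scheme.homeoOfIso hU.isoSpec).isHomeomorph

theorem exists_isAffineOpen_topologicalKrullDim_eq (X : Scheme.{u}) [CompactSpace X]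
    [Nonempty X] :
    ∃ U : X.Opens, IsAffineOpen U ∧ Nonempty U ∧ topologicalKrullDim X = ringKrullDim Γ(X, U) := by
  obtain ⟨s, hs, hcover⟩ := (isCompact_iff_finite_and_eq_biUnion_affineOpens
    (U := (⊤ : X.Opens))).mp isCompact_univ
  have : Finite s := hs
  have hcover' : ⨆ U : s, (U : X.Opens) = ⊤ := by rw [hcover, iSup_subtype]
  have : Nonempty s := by
    obtain ⟨x⟩ := ‹Nonempty X›
    obtain ⟨U, -⟩ := Opens.mem_iSup.mp (hcover'.ge (Opens.mem_top x))
    exact ⟨U⟩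
  obtain ⟨U, hU⟩ := exists_eq_ciSup_of_finite (f := fun U : s ↦ topologicalKrullDim (U : X.Opens))
  have hdim : topologicalKrullDim X = topologicalKrullDim (U : X.Opens) :=
    (topologicalKrullDim_eq_iSup_of_iSup_eq_top hcover').trans hU.symm
  refine ⟨U, U.1.2, ?_, hdim.trans (topologicalKrullDim_of_isAffineOpen U.1.2)⟩
  exact topologicalKrullDim_nonneg_iff.mp (hdim ▸ topologicalKrullDim_nonneg_iff.mpr inferInstance)

theorem dim_eq_of_topologicalKrullDim_eq {T : Type*} [TopologicalSpace T] {d : ℕ}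
    (h : topologicalKrullDim T = d) : dim T = d := by
  rw [dim, h]
  rfl

theorem topologicalKrullDim_eq_dim (p : X ⟶ Spec (CommRingCat.of k)) [LocallyOfFiniteType p]
    [CompactSpace X] [Nonempty X] : topologicalKrullDim X = dim X := by
  obtain ⟨U, hU, _, hdim⟩ := exists_isAffineOpen_topologicalKrullDim_eq X
  have := finiteType_sections p hU
  obtain ⟨d, hd⟩ := exists_ringKrullDim_eq_natCast k (Sections p U)
  rw [dim_eq_of_topologicalKrullDim_eq (hdim.trans hd), hdim.trans hd]

theorem topologicalKrullDim_fst_inf_snd (p : X ⟶ Spec (CommRingCat.of k))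
    (q : Y ⟶ Spec (CommRingCat.of k)) [LocallyOfFiniteType p] [LocallyOfFiniteType q]
    {U : X.Opens} {V : Y.Opens} (hU : IsAffineOpen U) (hV : IsAffineOpen V) :
    topologicalKrullDim ↥(pullback.fst p q ⁻¹ᵁ U ⊓ pullback.snd p q ⁻¹ᵁ V) =
      ringKrullDim Γ(X, U) + ringKrullDim Γ(Y, V) := by
  have := finiteType_sections p hU
  have := finiteType_sections q hV
  obtain ⟨e, -⟩ := exists_sections_tensorProduct_ringEquiv p q hU hV
  exact (topologicalKrullDim_of_isAffineOpen (isAffineOpen_fst_inf_snd p q hU hV)).trans <|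
    (ringKrullDim_eq_of_ringEquiv e).symm.trans (ringKrullDim_tensorProduct k _ _)

theorem topologicalKrullDim_pullback (p : X ⟶ Spec (CommRingCat.of k))
    (q : Y ⟶ Spec (CommRingCat.of k)) [LocallyOfFiniteType p] [LocallyOfFiniteType q]
    [CompactSpace X] [CompactSpace Y] [Nonempty X] [Nonempty Y] :
    topologicalKrullDim ↥(pullback p q) = topologicalKrullDim X + topologicalKrullDim Y := by
  refine le_antisymm ?_ ?_
  · have hcover : ⨆ UV : X.affineOpens × Y.affineOpens,
        pullback.fst p q ⁻¹ᵁ UV.1.1 ⊓ pullback.snd p q ⁻¹ᵁ UV.2.1 = ⊤ := by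
      refine top_unique fun z _ ↦ Opens.mem_iSup.mpr ?_
      obtain ⟨U, hU, hxU, -⟩ := exists_isAffineOpen_mem_and_subset
        (x := pullback.fst p q z) (U := ⊤) trivial
      obtain ⟨V, hV, hyV, -⟩ := exists_isAffineOpen_mem_and_subset
        (x := pullback.snd p q z) (U := ⊤) trivial
      exact ⟨(⟨U, hU⟩, ⟨V, hV⟩), hxU, hyV⟩
    rw [topologicalKrullDim_eq_iSup_of_iSup_eq_top hcover]
    refine iSup_le fun ⟨⟨U, hU⟩, ⟨V, hV⟩⟩ ↦ ?_
    dsimp only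
    rw [topologicalKrullDim_fst_inf_snd p q hU hV, ← topologicalKrullDim_of_isAffineOpen hU,
      ← topologicalKrullDim_of_isAffineOpen hV]
    exact add_le_add (topologicalKrullDim_subspace_le X U) (topologicalKrullDim_subspace_le Y V)
  · obtain ⟨U, hU, -, hdimX⟩ := exists_isAffineOpen_topologicalKrullDim_eq X
    obtain ⟨V, hV, -, hdimY⟩ := exists_isAffineOpen_topologicalKrullDim_eq Y
    rw [hdimX, hdimY, ← topologicalKrullDim_fst_inf_snd p q hU hV]
    exact topologicalKrullDim_subspace_le _ _

theorem dim_pullback (p : X ⟶ Spec (CommRingCat.of k)) (q : Y ⟶ Spec (CommRingCat.of k))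
    [LocallyOfFiniteType p] [LocallyOfFiniteType q] [CompactSpace X] [CompactSpace Y]
    [Nonempty X] [Nonempty Y] : dim ↥(pullback p q) = dim X + dim Y := by
  refine dim_eq_of_topologicalKrullDim_eq ?_
  rw [topologicalKrullDim_pullback, topologicalKrullDim_eq_dim p, topologicalKrullDim_eq_dim q]
  rfl

/-- The function field of `X` as a `k`-algebra; a type synonym of `X.functionField` which remembers
the structure morphism `p`, so that the algebra structure can be an instance. -/
def FunctionField [IrreducibleSpace X] (_p : X ⟶ Spec (CommRingCat.of k)) : Type u :=
  X.functionField

variable (p : X ⟶ Spec (CommRingCat.of k)) [IsIntegral X]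

noncomputable instance : Field (FunctionField p) := inferInstanceAs (Field X.functionField)

noncomputable instance : Algebra k (FunctionField p) :=
  RingHom.toAlgebra (S := FunctionField p)
    (sectionsBase p ⊤ ≫ X.presheaf.germ ⊤ (genericPoint X) trivial).hom

theorem trdeg_sections {U : X.Opens} (hU : IsAffineOpen U) [Nonempty U] :
    Algebra.trdeg k (Sections p U) = Algebra.trdeg k (FunctionField p) := by
  let : Algebra (Sections p U) (FunctionField p) :=
    RingHom.toAlgebra (R := Sections p U) (S := FunctionField p) (X.germToFunctionField U).hom
  have : IsFractionRing (Sections p U) (FunctionField p) :=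
    functionField_isFractionRing_of_isAffineOpen X U hU
  have : IsScalarTower k (Sections p U) (FunctionField p) := by
    refine .of_algebraMap_eq' ?_
    change _ = (X.germToFunctionField U).hom.comp (sectionsBase p U).hom
    rw [← sectionsBase_map p (le_top : U ≤ ⊤), ← CommRingCat.hom_comp, Category.assoc,
      Scheme.germToFunctionField, TopCat.Presheaf.germ_res]
    rfl
  have : FaithfulSMul (Sections p U) (FunctionField p) :=
    (faithfulSMul_iff_algebraMap_injective _ _).mpr (IsFractionRing.injective _ _)
  have : Algebra.IsAlgebraic (Sections p U) (FunctionField p) :=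
    IsLocalization.isAlgebraic _ (nonZeroDivisors (Sections p U))
  exact (trdeg_eq_of_isAlgebraic k (Sections p U) (FunctionField p)).symm

theorem ringKrullDim_sections_eq_toNat_trdeg [LocallyOfFiniteType p] {U : X.Opens}
    (hU : IsAffineOpen U) [Nonempty U] :
    ringKrullDim (Sections p U) = (Algebra.trdeg k (FunctionField p)).toNat := by
  have := finiteType_sections p hU
  rw [ringKrullDim_eq_toNat_trdeg (k := k), trdeg_sections p hU]

theorem ringKrullDim_sections_eq_dim [LocallyOfFiniteType p] [CompactSpace X] {U : X.Opens}
    (hU : IsAffineOpen U) [Nonempty U] : ringKrullDim (Sections p U) = dim X := by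
  obtain ⟨W, hW, _, hdim⟩ := exists_isAffineOpen_topologicalKrullDim_eq X
  rw [← topologicalKrullDim_eq_dim p, hdim, ringKrullDim_sections_eq_toNat_trdeg p hU]
  exact (ringKrullDim_sections_eq_toNat_trdeg p hW).symm

end Dimension

section Trunc

variable {k : Type u} [Field k] {m : ℕ}

theorem truncCoeff_mk (j : Fin (m + 1)) (f : Polynomial k) :
    truncCoeff k j (AdjoinRoot.mk (Polynomial.X ^ (m + 1)) f) = f.coeff j := by
  rw [truncCoeff, AdjoinRoot.modByMonicHom_mk]
  conv_rhs => rw [← Polynomial.modByMonic_add_div f (Polynomial.X ^ (m + 1))]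
  rw [Polynomial.coeff_add, Polynomial.coeff_X_pow_mul', if_neg (by omega), add_zero]

theorem truncCoeff_add (j : Fin (m + 1)) (a b : Trunc k m) :
    truncCoeff k j (a + b) = truncCoeff k j a + truncCoeff k j b := by
  simp [truncCoeff]

theorem truncCoeff_zero (j : Fin (m + 1)) : truncCoeff k j (0 : Trunc k m) = 0 := by
  simp [truncCoeff]

theorem truncCoeff_mul (j : Fin (m + 1)) (a b : Trunc k m) :
    truncCoeff k j (a * b) = ∑ i : Fin (j + 1), truncCoeff k ⟨i, by omega⟩ a *
      truncCoeff k ⟨j - i, by omega⟩ b := by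
  obtain ⟨f, rfl⟩ := AdjoinRoot.mk_surjective a
  obtain ⟨g, rfl⟩ := AdjoinRoot.mk_surjective b
  simp only [← map_mul, truncCoeff_mk]
  rw [Polynomial.coeff_mul, Finset.Nat.sum_antidiagonal_eq_sum_range_succ
    (fun i l ↦ f.coeff i * g.coeff l), Finset.sum_range]

theorem truncCoeff_algebraMap (j : Fin (m + 1)) (c : k) :
    truncCoeff k j (algebraMap k (Trunc k m) c) = if (j : ℕ) = 0 then c else 0 := by
  have : algebraMap k (Trunc k m) c = AdjoinRoot.mk _ (Polynomial.C c) := rfl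
  rw [this, truncCoeff_mk, Polynomial.coeff_C]

theorem trunc_ext {a b : Trunc k m} (h : ∀ j, truncCoeff k j a = truncCoeff k j b) : a = b := by
  obtain ⟨f, rfl⟩ := AdjoinRoot.mk_surjective a
  obtain ⟨g, rfl⟩ := AdjoinRoot.mk_surjective b
  simp only [truncCoeff_mk] at h
  rw [AdjoinRoot.mk_eq_mk, Polynomial.X_pow_dvd_iff]
  intro d hd
  simpa [sub_eq_zero] using h ⟨d, hd⟩

/-- The element of `k[t]/(t^(m+1))` with prescribed coefficients. -/
noncomputable def truncOf (c : Fin (m + 1) → k) : Trunc k m :=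
  AdjoinRoot.mk _ (∑ j : Fin (m + 1), Polynomial.monomial (j : ℕ) (c j))

theorem truncCoeff_truncOf (j : Fin (m + 1)) (c : Fin (m + 1) → k) :
    truncCoeff k j (truncOf c) = c j := by
  rw [truncOf, truncCoeff_mk, Polynomial.finsetSum_coeff]
  simp [Polynomial.coeff_monomial, Fin.val_inj]

/-- The truncated arc `B → k[t]/(t^(m+1))` with prescribed coefficient functions, which are to
satisfy the Leibniz rule `(ab)^(j) = ∑ a^(i) b^(j-i)`. -/
noncomputable def truncAlgHom {B : Type*} [CommRing B] [Algebra k B] (c : B → Fin (m + 1) → k)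
    (hadd : ∀ a b j, c (a + b) j = c a j + c b j)
    (hmul : ∀ a b j, c (a * b) j =
      ∑ i : Fin (j + 1), c a ⟨i, by omega⟩ * c b ⟨j - i, by omega⟩)
    (halg : ∀ r j, c (algebraMap k B r) j = if (j : ℕ) = 0 then r else 0) : B →ₐ[k] Trunc k m :=
  have hconst (r : k) : truncOf (c (algebraMap k B r)) = algebraMap k (Trunc k m) r :=
    trunc_ext fun j ↦ by rw [truncCoeff_truncOf, halg, truncCoeff_algebraMap]
  { toFun := fun a ↦ truncOf (c a)
    map_one' := by simpa using hconst 1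
    map_zero' := by simpa using hconst 0
    map_add' := fun a b ↦ trunc_ext fun j ↦ by simp only [truncCoeff_truncOf, truncCoeff_add, hadd]
    map_mul' := fun a b ↦ trunc_ext fun j ↦ by simp only [truncCoeff_truncOf, truncCoeff_mul, hmul]
    commutes' := hconst }

end Trunc

section FunctionAlgebra

theorem aeval_pi_apply {k σ T : Type*} [CommSemiring k] (f : σ → T → k) (F : MvPolynomial σ k)
    (t : T) : MvPolynomial.aeval f F t = MvPolynomial.eval (fun i ↦ f i t) F := by
  have h := congr($(MvPolynomial.comp_aeval (R := k) f (Pi.evalAlgHom k (fun _ : T ↦ k) t)) F)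
  rwa [MvPolynomial.aeval_eq_eval] at h

theorem injective_aeval_of_forall_exists_eq {k σ T : Type*} [CommRing k] [IsDomain k] [Infinite k]
    {f : σ → T → k} (hf : ∀ c : σ → k, ∃ t, ∀ i, f i t = c i) :
    Function.Injective (MvPolynomial.aeval f : MvPolynomial σ k →ₐ[k] (T → k)) := by
  rw [injective_iff_map_eq_zero]
  refine fun F hF ↦ MvPolynomial.funext fun c ↦ ?_
  obtain ⟨t, ht⟩ := hf c
  rw [map_zero, ← funext ht, ← aeval_pi_apply, hF, Pi.zero_apply]

/-- The pullback of functions along a map `g`, as a homomorphism of algebras. -/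
def precompHom (k : Type*) [CommSemiring k] {S T : Type*} (g : S → T) :
    (T → k) →ₐ[k] (S → k) where
  toFun f := f ∘ g
  map_one' := rfl
  map_mul' _ _ := rfl
  map_zero' := rfl
  map_add' _ _ := rfl
  commutes' _ := rfl

variable {k : Type*} [Field k] {S S' Z : Type*}

theorem tensorProduct_eq_zero_of_forall_eval (A : Subalgebra k (S → k))
    (A' : Subalgebra k (S' → k)) (t : A ⊗[k] A')
    (h : ∀ s s', Algebra.TensorProduct.productMap
      ((Pi.evalAlgHom k (fun _ : S ↦ k) s).comp A.val)
      ((Pi.evalAlgHom k (fun _ : S' ↦ k) s').comp A'.val) t = 0) : t = 0 := by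
  classical
  let b := Module.Basis.ofVectorSpace k A'
  obtain ⟨c, hc⟩ : ∃ c, t = (TensorProduct.equivFinsuppOfBasisRight b).symm c :=
    ⟨_, (LinearEquiv.symm_apply_apply _ _).symm⟩
  rw [TensorProduct.equivFinsuppOfBasisRight_symm_apply] at hc
  suffices hc0 : c = 0 by rw [hc, hc0, Finsupp.sum_zero_index]
  ext i s
  have hsum : c.sum (fun i a ↦ (a : S → k) s • b i) = 0 := by
    ext s'
    have hss' := h s s'
    rw [hc, Finsupp.sum, map_sum] at hss'
    rw [Finsupp.sum, AddSubmonoidClass.coe_finsetSum, Finset.sum_apply]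
    simpa using hss'
  have hlin := linearIndependent_iff'.mp b.linearIndependent c.support
    (fun i ↦ (c i : S → k) s) hsum
  by_cases hi : i ∈ c.support
  · simpa using hlin i hi
  · simp [Finsupp.notMem_support_iff.mp hi]

theorem injective_productMap_precompHom (A : Subalgebra k (S → k)) (A' : Subalgebra k (S' → k))
    {g : Z → S} {g' : Z → S'} (hg : ∀ s s', ∃ z, g z = s ∧ g' z = s') :
    Function.Injective (Algebra.TensorProduct.productMap ((precompHom k g).comp A.val)
      ((precompHom k g').comp A'.val)) := by
  rw [injective_iff_map_eq_zero]
  refine fun t ht ↦ tensorProduct_eq_zero_of_forall_eval _ _ t fun s s' ↦ ?_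
  obtain ⟨z, rfl, rfl⟩ := hg s s'
  have hz : (Pi.evalAlgHom k (fun _ : Z ↦ k) z).comp (Algebra.TensorProduct.productMap
      ((precompHom k g).comp A.val) ((precompHom k g').comp A'.val)) =
      Algebra.TensorProduct.productMap
        ((Pi.evalAlgHom k (fun _ : S ↦ k) (g z)).comp A.val)
        ((Pi.evalAlgHom k (fun _ : S' ↦ k) (g' z)).comp A'.val) := by
    ext x
    · simp only [Algebra.TensorProduct.productMap_left, AlgHom.comp_assoc]
      rfl
    · simp only [AlgHom.coe_comp, AlgHom.coe_restrictScalars', Function.comp_apply,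
        Algebra.TensorProduct.includeRight_apply, Algebra.TensorProduct.productMap_apply_tmul,
        map_one, one_mul]
      rfl
  rw [← hz, AlgHom.comp_apply, ht, map_zero]

end FunctionAlgebra

section CoordAlg

variable {k : Type u} [Field k] {m : ℕ} {B : Type*} [CommRing B] [Algebra k B] {T : Type*}
  (ev : T → (B →ₐ[k] Trunc k m))

/-- The coordinate `a^(j)`, that is, the `j`-th coefficient of the image of `a ∈ B`, as a function
on a family `ev` of truncated arcs. -/
noncomputable def coordFun (a : B) (j : Fin (m + 1)) : T → k := fun t ↦ truncCoeff k j (ev t a)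

/-- The `k`-algebra of functions generated by the coordinates `a^(j)` on a family of truncated
arcs. It plays the role of the coordinate ring of the Zariski closure of the family. -/
noncomputable def coordAlg : Subalgebra k (T → k) :=
  Algebra.adjoin k (Set.range fun q : B × Fin (m + 1) ↦ coordFun ev q.1 q.2)

theorem coordFun_mem (a : B) (j : Fin (m + 1)) : coordFun ev a j ∈ coordAlg ev :=
  Algebra.subset_adjoin ⟨(a, j), rfl⟩

/-- The coordinate `a^(j)` as an element of the coordinate algebra. -/
noncomputable def coordElem (a : B) (j : Fin (m + 1)) : coordAlg ev :=
  ⟨coordFun ev a j, coordFun_mem ev a j⟩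

variable {ev}

theorem coordElem_add (a b : B) (j : Fin (m + 1)) :
    coordElem ev (a + b) j = coordElem ev a j + coordElem ev b j :=
  Subtype.ext <| funext fun t ↦ by simp [coordElem, coordFun, truncCoeff_add]

theorem coordElem_mul (a b : B) (j : Fin (m + 1)) :
    coordElem ev (a * b) j =
      ∑ i : Fin (j + 1), coordElem ev a ⟨i, by omega⟩ * coordElem ev b ⟨j - i, by omega⟩ :=
  Subtype.ext <| funext fun t ↦ by simp [coordElem, coordFun, truncCoeff_mul]

theorem coordElem_algebraMap (c : k) (j : Fin (m + 1)) :
    coordElem ev (algebraMap k B c) j = algebraMap k _ (if (j : ℕ) = 0 then c else 0) := by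
  refine Subtype.ext <| funext fun t ↦ ?_
  simp only [coordElem, coordFun, AlgHom.commutes, truncCoeff_algebraMap]
  rfl

theorem mem_coordAlg_iff (f : T → k) : f ∈ coordAlg ev ↔
    ∃ F : MvPolynomial (B × Fin (m + 1)) k,
      f = fun t ↦ MvPolynomial.eval (fun q ↦ truncCoeff k q.2 (ev t q.1)) F := by
  rw [coordAlg, Algebra.adjoin_range_eq_range_aeval]
  refine exists_congr fun F ↦ ?_
  have hF := funext (aeval_pi_apply (fun q : B × Fin (m + 1) ↦ coordFun ev q.1 q.2) F)
  exact ⟨fun h ↦ h.symm.trans hF, fun h ↦ hF.trans h.symm⟩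

theorem coordAlg_le_iff {Q : Subalgebra k (T → k)} :
    coordAlg ev ≤ Q ↔ ∀ a j, coordFun ev a j ∈ Q := by
  rw [coordAlg, Algebra.adjoin_le_iff, Set.range_subset_iff]
  exact ⟨fun h a j ↦ h (a, j), fun h q ↦ h q.1 q.2⟩

theorem coordFun_mem_of_mem_adjoin {s : Set B} {Q : Subalgebra k (T → k)}
    (h : ∀ a ∈ s, ∀ j, coordFun ev a j ∈ Q) {a : B} (ha : a ∈ Algebra.adjoin k s)
    (j : Fin (m + 1)) : coordFun ev a j ∈ Q := by
  induction ha using Algebra.adjoin_induction generalizing j with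
  | mem x hx => exact h x hx j
  | algebraMap c =>
    have hc : coordFun ev (algebraMap k B c) j = algebraMap k (T → k) _ :=
      congrArg Subtype.val (coordElem_algebraMap c j)
    exact hc ▸ Q.algebraMap_mem _
  | add x y _ _ hx hy =>
    have hxy : coordFun ev (x + y) j = coordFun ev x j + coordFun ev y j :=
      congrArg Subtype.val (coordElem_add x y j)
    exact hxy ▸ Q.add_mem (hx j) (hy j)
  | mul x y _ _ hx hy =>
    have hxy : coordFun ev (x * y) j = ∑ i : Fin (j + 1),
        coordFun ev x ⟨i, by omega⟩ * coordFun ev y ⟨j - i, by omega⟩ := by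
      ext t
      simp [coordFun, truncCoeff_mul]
    exact hxy ▸ Q.sum_mem fun i _ ↦ Q.mul_mem (hx _) (hy _)

instance [Algebra.FiniteType k B] : Algebra.FiniteType k (coordAlg ev) := by
  obtain ⟨s, hs⟩ := Algebra.FiniteType.out (R := k) (A := B)
  have hfg : coordAlg ev = Algebra.adjoin k
      ((fun q : B × Fin (m + 1) ↦ coordFun ev q.1 q.2) '' ((s : Set B) ×ˢ Set.univ)) := by
    refine le_antisymm (coordAlg_le_iff.mpr fun a j ↦ ?_)
      (Algebra.adjoin_mono (Set.image_subset_range _ _))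
    refine coordFun_mem_of_mem_adjoin (fun b hb j ↦ ?_) (hs ▸ Algebra.mem_top : a ∈ _) j
    exact Algebra.subset_adjoin ⟨(b, j), ⟨hb, trivial⟩, rfl⟩
  rw [← Subalgebra.fg_iff_finiteType, hfg]
  exact Subalgebra.fg_def.mpr ⟨_, (s.finite_toSet.prod Set.finite_univ).image _, rfl⟩

/-- The truncated arc defined by a `k`-point of the coordinate algebra: the coefficients of the
image of `a` are the values of the coordinates `a^(j)` at that point. -/
noncomputable def arcOfPoint (φ : coordAlg ev →ₐ[k] k) : B →ₐ[k] Trunc k m :=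
  truncAlgHom (fun a j ↦ φ (coordElem ev a j)) (fun a b j ↦ by rw [coordElem_add, map_add])
    (fun a b j ↦ by simp only [coordElem_mul, map_sum, map_mul])
    (fun c j ↦ by rw [coordElem_algebraMap, AlgHom.commutes, Algebra.algebraMap_self_apply])

theorem truncCoeff_arcOfPoint (φ : coordAlg ev →ₐ[k] k) (a : B) (j : Fin (m + 1)) :
    truncCoeff k j (arcOfPoint φ a) = φ (coordElem ev a j) :=
  truncCoeff_truncOf _ _

theorem eval_truncCoeff_arcOfPoint (φ : coordAlg ev →ₐ[k] k)
    (F : MvPolynomial (B × Fin (m + 1)) k) (f : coordAlg ev)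
    (hf : ∀ t, (f : T → k) t = MvPolynomial.eval (fun q ↦ truncCoeff k q.2 (ev t q.1)) F) :
    MvPolynomial.eval (fun q ↦ truncCoeff k q.2 (arcOfPoint φ q.1)) F = φ f := by
  have hfF : f = MvPolynomial.aeval (fun q : B × Fin (m + 1) ↦ coordElem ev q.1 q.2) F := by
    have hval := congr($(MvPolynomial.comp_aeval (R := k)
      (fun q : B × Fin (m + 1) ↦ coordElem ev q.1 q.2) (coordAlg ev).val) F)
    refine Subtype.ext <| Eq.trans (funext fun t ↦ ?_) hval.symm
    rw [hf]
    exact (aeval_pi_apply (fun q : B × Fin (m + 1) ↦ coordFun ev q.1 q.2) F t).symm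
  simp only [truncCoeff_arcOfPoint]
  rw [hfF, ← AlgHom.comp_apply, MvPolynomial.comp_aeval, MvPolynomial.aeval_eq_eval]

theorem map_precompHom_coordAlg {S : Type*} (g : S → T) :
    (coordAlg ev).map (precompHom k g) = coordAlg (ev ∘ g) := by
  rw [coordAlg, AlgHom.map_adjoin, ← Set.range_comp]
  rfl

theorem ringKrullDim_coordAlg_comp {S : Type*} (g : S → T)
    (h : ∀ f ∈ coordAlg ev, f ∘ g = 0 → f = 0) :
    ringKrullDim (coordAlg (ev ∘ g)) = ringKrullDim (coordAlg ev) := by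
  have hinj : Function.Injective ((precompHom k g).comp (coordAlg ev).val) :=
    (injective_iff_map_eq_zero _).mpr fun f hf ↦ Subtype.ext (h f f.2 hf)
  rw [ringKrullDim_eq_of_ringEquiv (AlgEquiv.ofInjective _ hinj).toRingEquiv, AlgHom.range_comp,
    Subalgebra.range_val, map_precompHom_coordAlg]

end CoordAlg

section CoordAlgDimension

variable {k : Type u} [Field k] {m : ℕ} {B C D : Type*} [CommRing B] [Algebra k B] [CommRing C]
  [Algebra k C] [CommRing D] [Algebra k D] {S S' Z : Type*} {ev : S → (B →ₐ[k] Trunc k m)}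
  {ev' : S' → (C →ₐ[k] Trunc k m)} {evz : Z → (D →ₐ[k] Trunc k m)}

theorem coordAlg_eq_sup_map_precompHom {g : Z → S} {g' : Z → S'} {β : B →ₐ[k] D} {β' : C →ₐ[k] D}
    (hgen : Algebra.adjoin k (Set.range β ∪ Set.range β') = ⊤)
    (h : ∀ z b, evz z (β b) = ev (g z) b) (h' : ∀ z c, evz z (β' c) = ev' (g' z) c) :
    coordAlg evz = (coordAlg ev).map (precompHom k g) ⊔ (coordAlg ev').map (precompHom k g') := by
  have hfun (b : B) (j) : coordFun evz (β b) j = precompHom k g (coordFun ev b j) :=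
    funext fun z ↦ congrArg (truncCoeff k j) (h z b)
  have hfun' (c : C) (j) : coordFun evz (β' c) j = precompHom k g' (coordFun ev' c j) :=
    funext fun z ↦ congrArg (truncCoeff k j) (h' z c)
  refine le_antisymm (coordAlg_le_iff.mpr fun d j ↦ ?_) (sup_le ?_ ?_)
  · refine coordFun_mem_of_mem_adjoin ?_ (hgen ▸ Algebra.mem_top : d ∈ _) j
    rintro _ (⟨b, rfl⟩ | ⟨c, rfl⟩) j
    · exact hfun b j ▸ Algebra.mem_sup_left ⟨_, coordFun_mem ev b j, rfl⟩
    · exact hfun' c j ▸ Algebra.mem_sup_right ⟨_, coordFun_mem ev' c j, rfl⟩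
  · exact Subalgebra.map_le.mpr <| coordAlg_le_iff.mpr fun b j ↦
      (Subalgebra.mem_comap ..).mpr <| hfun b j ▸ coordFun_mem evz (β b) j
  · exact Subalgebra.map_le.mpr <| coordAlg_le_iff.mpr fun c j ↦
      (Subalgebra.mem_comap ..).mpr <| hfun' c j ▸ coordFun_mem evz (β' c) j

theorem ringKrullDim_coordAlg_prod [Algebra.FiniteType k B] [Algebra.FiniteType k C]
    {g : Z → S} {g' : Z → S'} (hg : ∀ s s', ∃ z, g z = s ∧ g' z = s')
    {β : B →ₐ[k] D} {β' : C →ₐ[k] D} (hgen : Algebra.adjoin k (Set.range β ∪ Set.range β') = ⊤)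
    (h : ∀ z b, evz z (β b) = ev (g z) b) (h' : ∀ z c, evz z (β' c) = ev' (g' z) c) :
    ringKrullDim (coordAlg evz) = ringKrullDim (coordAlg ev) + ringKrullDim (coordAlg ev') := by
  let P := Algebra.TensorProduct.productMap ((precompHom k g).comp (coordAlg ev).val)
    ((precompHom k g').comp (coordAlg ev').val)
  have hinj : Function.Injective P := injective_productMap_precompHom _ _ hg
  have hrange : P.range = coordAlg evz := by
    rw [Algebra.TensorProduct.productMap_range, AlgHom.range_comp, AlgHom.range_comp,
      Subalgebra.range_val, Subalgebra.range_val, coordAlg_eq_sup_map_precompHom hgen h h']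
  rw [← hrange, ← ringKrullDim_eq_of_ringEquiv (AlgEquiv.ofInjective P hinj).toRingEquiv,
    ringKrullDim_tensorProduct k]

theorem coordAlg_eq_adjoin_of_coordinates {ι : Type*} {x : ι → B}
    (hconst : ∀ i, ∃ c : k, ∀ s, truncCoeff k 0 (ev s (x i)) = c)
    (hgen : ∀ b, ∃ a ∈ Algebra.adjoin k (Set.range x), ∀ s, ev s b = ev s a) :
    coordAlg ev =
      Algebra.adjoin k (Set.range fun q : ι × Fin m ↦ coordFun ev (x q.1) q.2.succ) := by
  refine le_antisymm (coordAlg_le_iff.mpr fun b j ↦ ?_) (Algebra.adjoin_le ?_)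
  · obtain ⟨a, ha, hab⟩ := hgen b
    have hba : coordFun ev b j = coordFun ev a j := funext fun s ↦ congrArg _ (hab s)
    rw [hba]
    refine coordFun_mem_of_mem_adjoin ?_ ha j
    rintro _ ⟨i, rfl⟩ j
    induction j using Fin.cases with
    | zero =>
      obtain ⟨c, hc⟩ := hconst i
      exact (funext hc : coordFun ev (x i) 0 = algebraMap k (S → k) c) ▸
        Subalgebra.algebraMap_mem _ c
    | succ j => exact Algebra.subset_adjoin ⟨(i, j), rfl⟩
  · rintro _ ⟨q, rfl⟩
    exact coordFun_mem ev _ _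

theorem ringKrullDim_coordAlg_of_coordinates [Infinite k] {ι : Type*} [Finite ι] {x : ι → B}
    (hconst : ∀ i, ∃ c : k, ∀ s, truncCoeff k 0 (ev s (x i)) = c)
    (hgen : ∀ b, ∃ a ∈ Algebra.adjoin k (Set.range x), ∀ s, ev s b = ev s a)
    (hsurj : ∀ c : ι × Fin m → k, ∃ s, ∀ i (j : Fin m),
      truncCoeff k j.succ (ev s (x i)) = c (i, j)) :
    ringKrullDim (coordAlg ev) = (Nat.card ι * m : ℕ) := by
  let P : MvPolynomial (ι × Fin m) k →ₐ[k] (S → k) :=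
    MvPolynomial.aeval fun q ↦ coordFun ev (x q.1) q.2.succ
  have hinj : Function.Injective P :=
    injective_aeval_of_forall_exists_eq fun c ↦ (hsurj c).imp fun s hs q ↦ hs q.1 q.2
  have hrange : P.range = coordAlg ev :=
    ((coordAlg_eq_adjoin_of_coordinates hconst hgen).trans
      (Algebra.adjoin_range_eq_range_aeval ..)).symm
  rw [← hrange, ← ringKrullDim_eq_of_ringEquiv (AlgEquiv.ofInjective P hinj).toRingEquiv,
    ringKrullDim_mvPolynomial_field, Nat.card_prod, Nat.card_fin]

end CoordAlgDimension

section FunctionAlgebraTopology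

variable {k : Type u} [Field k]

theorem exists_algHom_ker_eq [IsAlgClosed k] (A : Type*) [CommRing A] [Algebra k A]
    [Algebra.FiniteType k A] (M : Ideal A) [M.IsMaximal] :
    ∃ φ : A →ₐ[k] k, RingHom.ker φ = M := by
  let := Ideal.Quotient.field M
  have : Module.Finite k (A ⧸ M) := finite_of_finite_type_of_isJacobsonRing k (A ⧸ M)
  let e : k ≃ₐ[k] A ⧸ M := AlgEquiv.ofBijective (Algebra.ofId k (A ⧸ M))
    IsAlgClosed.algebraMap_bijective_of_isIntegral
  refine ⟨(e.symm : (A ⧸ M) →ₐ[k] k).comp (Ideal.Quotient.mkₐ k M), ?_⟩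
  ext a
  simp [RingHom.mem_ker, Ideal.Quotient.eq_zero_iff_mem]

variable {T : Type*} (A : Subalgebra k (T → k))

/-- The point of the spectrum of an algebra `A` of functions on `T` given by evaluation at `t`. -/
def evalPoint (t : T) : PrimeSpectrum A :=
  ⟨RingHom.ker ((Pi.evalAlgHom k (fun _ : T ↦ k) t).comp A.val), RingHom.ker_isPrime _⟩

variable {A}

theorem mem_evalPoint_iff {t : T} {f : A} : f ∈ (evalPoint A t).asIdeal ↔ (f : T → k) t = 0 :=
  Iff.rfl

theorem isInducing_evalPoint [TopologicalSpace T]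
    (hA : IsTopologicalBasis (Set.range fun f : A ↦ {t | (f : T → k) t ≠ 0})) :
    IsInducing (evalPoint A) := by
  refine ⟨?_⟩
  rw [hA.eq_generateFrom, PrimeSpectrum.isTopologicalBasis_basic_opens.eq_generateFrom,
    induced_generateFrom_eq, ← Set.range_comp]
  rfl

theorem topologicalKrullDim_eq_ringKrullDim_of_isTopologicalBasis [IsAlgClosed k]
    [TopologicalSpace T] [Algebra.FiniteType k A]
    (hA : IsTopologicalBasis (Set.range fun f : A ↦ {t | (f : T → k) t ≠ 0}))
    (hpoint : ∀ φ : A →ₐ[k] k, ∃ t, ∀ f : A, φ f = (f : T → k) t) :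
    topologicalKrullDim T = ringKrullDim A := by
  rw [← PrimeSpectrum.topologicalKrullDim_eq_ringKrullDim]
  refine topologicalKrullDim_eq_of_isInducing (isInducing_evalPoint hA) fun Z hZ ↦ ?_
  have : IsJacobsonRing A := isJacobsonRing_of_finiteType (A := k)
  refine (JacobsonSpace.closure_inter_closedPoints hZ).symm.subset.trans (closure_mono ?_)
  rintro M ⟨hMZ, hM⟩
  have : M.asIdeal.IsMaximal := (PrimeSpectrum.isClosed_singleton_iff_isMaximal M).mp hM
  obtain ⟨φ, hφ⟩ := exists_algHom_ker_eq (k := k) A M.asIdeal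
  obtain ⟨t, ht⟩ := hpoint φ
  have htM : evalPoint A t = M := by
    ext f
    rw [mem_evalPoint_iff, ← ht, ← hφ, RingHom.mem_ker]
  exact ⟨t, by rwa [Set.mem_preimage, htM], htM⟩

end FunctionAlgebraTopology

section TruncLocal

variable {k : Type u} [Field k] {m : ℕ}

/-- The constant coefficient `k[t]/(t^(m+1)) → k`, as a homomorphism of `k`-algebras. -/
noncomputable def truncResidue (k : Type u) [Field k] (m : ℕ) : Trunc k m →ₐ[k] k where
  toFun := truncCoeff k 0
  map_one' := (truncCoeff_algebraMap (k := k) (m := m) 0 1).trans (if_pos rfl)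
  map_mul' a b := by
    rw [truncCoeff_mul]
    exact Fintype.sum_unique (ι := Fin 1) (fun _ ↦ truncCoeff k 0 a * truncCoeff k 0 b)
  map_zero' := truncCoeff_zero _
  map_add' := truncCoeff_add _
  commutes' c := (truncCoeff_algebraMap 0 c).trans (if_pos rfl)

theorem truncResidue_apply (a : Trunc k m) : truncResidue k m a = truncCoeff k 0 a := rfl

theorem truncCoeff_sub_algebraMap_eq_zero_iff {a : Trunc k m} {c : k} :
    truncCoeff k 0 (a - algebraMap k _ c) = 0 ↔ truncCoeff k 0 a = c := by
  rw [← truncResidue_apply, map_sub, AlgHom.commutes, sub_eq_zero, truncResidue_apply]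
  rfl

theorem pow_eq_zero_of_truncCoeff_zero {a : Trunc k m} (h : truncCoeff k 0 a = 0) :
    a ^ (m + 1) = 0 := by
  obtain ⟨f, rfl⟩ := AdjoinRoot.mk_surjective a
  rw [truncCoeff_mk, Fin.val_zero, ← Polynomial.X_dvd_iff] at h
  rw [← map_pow, AdjoinRoot.mk_eq_zero]
  exact pow_dvd_pow_of_dvd h _

theorem exists_forall_mul_eq_one {B : Type*} [CommRing B] [Algebra k B] (b : B) {c : k}
    (hc : c ≠ 0) :
    ∃ e : B, ∀ φ : B →ₐ[k] Trunc k m, truncCoeff k 0 (φ b) = c → φ e * φ b = 1 := by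
  have hcop : IsCoprime (b - algebraMap k B c) b := by
    refine ⟨-algebraMap k B c⁻¹, algebraMap k B c⁻¹, ?_⟩
    have hinv : algebraMap k B c⁻¹ * algebraMap k B c = 1 := by
      rw [← map_mul, inv_mul_cancel₀ hc, map_one]
    linear_combination hinv
  obtain ⟨u, e, hue⟩ := hcop.pow_left (m := m + 1)
  refine ⟨e, fun φ hφ ↦ ?_⟩
  have hpow : φ (b - algebraMap k B c) ^ (m + 1) = 0 := by
    rw [map_sub, φ.commutes]
    exact pow_eq_zero_of_truncCoeff_zero (truncCoeff_sub_algebraMap_eq_zero_iff.mpr hφ)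
  simpa only [map_add, map_mul, map_pow, map_one, hpow, mul_zero, zero_add] using congrArg φ hue

theorem isUnit_trunc_iff {a : Trunc k m} : IsUnit a ↔ truncCoeff k 0 a ≠ 0 := by
  refine ⟨fun h ↦ (h.map (truncResidue k m)).ne_zero, fun h ↦ ?_⟩
  obtain ⟨e, he⟩ := exists_forall_mul_eq_one (m := m) a h
  exact .of_mul_eq_one_right _ (he (AlgHom.id k _) rfl)

instance : Nontrivial (Trunc k m) := (truncResidue k m).toRingHom.domain_nontrivial

instance : Subsingleton ↥(Spec (CommRingCat.of (Trunc k m))) := by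
  suffices h : ∀ P : PrimeSpectrum (Trunc k m), P.asIdeal = RingHom.ker (truncResidue k m) from
    ⟨fun P Q ↦ PrimeSpectrum.ext ((h P).trans (h Q).symm)⟩
  intro P
  ext a
  rw [RingHom.mem_ker, truncResidue_apply]
  constructor
  · intro ha
    by_contra h
    exact P.isPrime.ne_top (P.asIdeal.eq_top_of_isUnit_mem ha (isUnit_trunc_iff.mpr h))
  · intro h
    refine P.isPrime.mem_of_pow_mem (m + 1) ?_
    rw [pow_eq_zero_of_truncCoeff_zero h]
    exact P.asIdeal.zero_mem

/-- The only point of `Spec k[t]/(t^(m+1))`. -/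
noncomputable def truncPoint (k : Type u) [Field k] (m : ℕ) :
    ↥(Spec (CommRingCat.of (Trunc k m))) :=
  Classical.choice (inferInstanceAs (Nonempty (PrimeSpectrum (Trunc k m))))

theorem truncMap_mk {n m : ℕ} (h : n ≤ m) (f : Polynomial k) :
    truncMap k h (AdjoinRoot.mk _ f) = AdjoinRoot.mk _ f := by
  refine Eq.trans ?_ (AdjoinRoot.aeval_eq f)
  rfl

theorem truncCoeff_truncMap {n m : ℕ} (h : n ≤ m) (a : Trunc k m) (j : Fin (n + 1)) :
    truncCoeff k j (truncMap k h a) = truncCoeff k ⟨j, by omega⟩ a := by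
  obtain ⟨f, rfl⟩ := AdjoinRoot.mk_surjective a
  rw [truncMap_mk, truncCoeff_mk, truncCoeff_mk]

end TruncLocal

section SpecPullback

variable {R : CommRingCat.{u}} {X : Scheme.{u}}

/-- The pullback `f^* : 𝒪(U) → R` of sections along a morphism `f : Spec R ⟶ X` which factors
through `U`. -/
noncomputable def specPullback (f : Spec R ⟶ X) (U : X.Opens) (e : ⊤ ≤ f ⁻¹ᵁ U) : Γ(X, U) ⟶ R :=
  f.appLE U ⊤ e ≫ (Scheme.ΓSpecIso R).hom

theorem specPullback_map (f : Spec R ⟶ X) {U V : X.Opens} (h : U ≤ V) (e : ⊤ ≤ f ⁻¹ᵁ U)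
    (e' : ⊤ ≤ f ⁻¹ᵁ V) :
    X.presheaf.map (homOfLE h).op ≫ specPullback f U e = specPullback f V e' := by
  rw [specPullback, specPullback, ← Category.assoc, Scheme.Hom.map_appLE]

theorem appLE_comp_specPullback {Z : Scheme.{u}} (f : Spec R ⟶ X) (g : X ⟶ Z) {U : X.Opens}
    {W : Z.Opens} (h : U ≤ g ⁻¹ᵁ W) (e : ⊤ ≤ f ⁻¹ᵁ U) (e' : ⊤ ≤ (f ≫ g) ⁻¹ᵁ W) :
    g.appLE W U h ≫ specPullback f U e = specPullback (f ≫ g) W e' := by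
  rw [specPullback, specPullback, ← Category.assoc, Scheme.Hom.appLE_comp_appLE]

theorem specPullback_specMap {S : CommRingCat.{u}} (φ : S ⟶ R) (e : ⊤ ≤ Spec.map φ ⁻¹ᵁ ⊤) :
    specPullback (Spec.map φ) ⊤ e = (Scheme.ΓSpecIso S).hom ≫ φ := by
  rw [specPullback, ← Scheme.ΓSpecIso_naturality]
  congr 1

theorem specPullback_specMap_comp {S : CommRingCat.{u}} (φ : S ⟶ R) (f : Spec S ⟶ X) (U : X.Opens)
    (e : ⊤ ≤ f ⁻¹ᵁ U) (e' : ⊤ ≤ (Spec.map φ ≫ f) ⁻¹ᵁ U) :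
    specPullback (Spec.map φ ≫ f) U e' = specPullback f U e ≫ φ := by
  rw [← appLE_comp_specPullback (Spec.map φ) f e (le_preimage_top _ _), specPullback_specMap,
    specPullback, Category.assoc]

theorem specPullback_fromSpec {U : X.Opens} (hU : IsAffineOpen U) (e : ⊤ ≤ hU.fromSpec ⁻¹ᵁ U) :
    specPullback hU.fromSpec U e = 𝟙 Γ(X, U) := by
  rw [specPullback, Scheme.Hom.appLE, hU.fromSpec_app_self, Category.assoc, Category.assoc,
    ← Category.assoc ((Spec Γ(X, U)).presheaf.map _), ← Functor.map_comp, Iso.inv_comp_eq]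
  exact (congrArg (· ≫ _) ((Spec Γ(X, U)).presheaf.map_id _)).trans
    ((Category.id_comp _).trans (Category.comp_id _).symm)

theorem mem_basicOpen_of_isUnit_specPullback (f : Spec R ⟶ X) {U : X.Opens} (e : ⊤ ≤ f ⁻¹ᵁ U)
    (g : Γ(X, U)) (h : IsUnit (specPullback f U e g)) (s : ↥(Spec R)) :
    f s ∈ X.basicOpen g := by
  have hunit : IsUnit (f.appLE U ⊤ e g) := by
    simpa [specPullback] using h.map (Scheme.ΓSpecIso R).inv.hom
  have hs : s ∈ (Spec R).basicOpen (f.appLE U ⊤ e g) := by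
    rw [Scheme.basicOpen_of_isUnit _ hunit]
    trivial
  rw [Scheme.basicOpen_appLE] at hs
  exact hs.2

theorem sectionsBase_comp_specPullback {k : Type u} [Field k] (p : X ⟶ Spec (CommRingCat.of k))
    (f : Spec R ⟶ X) (φ : CommRingCat.of k ⟶ R) (hf : f ≫ p = Spec.map φ) (U : X.Opens)
    (e : ⊤ ≤ f ⁻¹ᵁ U) : sectionsBase p U ≫ specPullback f U e = φ := by
  rw [sectionsBase, Category.assoc, appLE_comp_specPullback f p _ e (le_preimage_top _ _),
    Iso.inv_comp_eq]
  simp only [hf, specPullback_specMap]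

theorem fromSpec_comp_structure {k : Type u} [Field k] (p : X ⟶ Spec (CommRingCat.of k))
    {U : X.Opens} (hU : IsAffineOpen U) : hU.fromSpec ≫ p = Spec.map (sectionsBase p U) := by
  rw [← IsAffineOpen.SpecMap_appLE_fromSpec p (isAffineOpen_top _) hU (le_preimage_top p U),
    IsAffineOpen.fromSpec_top, Scheme.isoSpec_Spec_inv, ← Spec.map_comp]
  rfl

end SpecPullback

section Jets

variable {k : Type u} [Field k] {X : Scheme.{u}} {p : X ⟶ Spec (CommRingCat.of k)} {m : ℕ}

/-- The point at which a jet is centred. -/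
noncomputable def Jet.center (γ : Jet p m) : X := γ.hom (truncPoint k m)

theorem Jet.hom_apply (γ : Jet p m) (s : ↥(Spec (CommRingCat.of (Trunc k m)))) :
    γ.hom s = γ.center := by
  rw [Jet.center, Subsingleton.elim s]

theorem Jet.liesIn_iff {γ : Jet p m} {U : X.Opens} : γ.LiesIn U ↔ γ.center ∈ U :=
  ⟨fun h ↦ h (x := truncPoint k m) trivial, fun h s _ ↦ by
    change γ.hom s ∈ U
    rwa [γ.hom_apply]⟩

theorem Jet.center_trunc {n : ℕ} (h : n ≤ m) (γ : Jet p m) : (γ.trunc h).center = γ.center :=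
  γ.hom_apply _

theorem Jet.pullbackFun_map (γ : Jet p m) {U V : X.Opens} (hUV : U ≤ V) (hU : γ.LiesIn U)
    (hV : γ.LiesIn V) (a : Γ(X, V)) :
    γ.pullbackFun hU (X.presheaf.map (homOfLE hUV).op a) = γ.pullbackFun hV a :=
  congr($(specPullback_map γ.hom hUV hU hV) a)

theorem Jet.pullbackFun_sectionsBase (γ : Jet p m) {U : X.Opens} (hU : γ.LiesIn U) (c : k) :
    γ.pullbackFun hU ((sectionsBase p U).hom c) = algebraMap k (Trunc k m) c :=
  congr($(sectionsBase_comp_specPullback p γ.hom _ γ.w U hU) c)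

/-- The pullback of sections along a jet, as a homomorphism of `k`-algebras. -/
noncomputable def Jet.pullbackHom (γ : Jet p m) {U : X.Opens} (hU : γ.LiesIn U) :
    Sections p U →ₐ[k] Trunc k m where
  __ := (γ.pullbackFun hU : Γ(X, U) →+* Trunc k m)
  commutes' c := γ.pullbackFun_sectionsBase hU c

theorem Jet.center_mem_basicOpen_iff (γ : Jet p m) {U : X.Opens} (hU : γ.LiesIn U) (g : Γ(X, U)) :
    γ.center ∈ X.basicOpen g ↔ truncCoeff k 0 (γ.pullbackFun hU g) ≠ 0 := by
  rw [← isUnit_trunc_iff]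
  refine ⟨fun h ↦ ?_, fun h ↦ mem_basicOpen_of_isUnit_specPullback γ.hom hU g h _⟩
  rw [← γ.pullbackFun_map (X.basicOpen_le g) (Jet.liesIn_iff.mpr h) hU g]
  exact (X.toRingedSpace.isUnit_res_basicOpen g).map _

theorem Jet.truncCoeff_zero_eq_of_center_eq {n : ℕ} {γ : Jet p m} {δ : Jet p n}
    (hγδ : γ.center = δ.center) {U : X.Opens} (hγ : γ.LiesIn U) (hδ : δ.LiesIn U) (g : Γ(X, U)) :
    truncCoeff k 0 (γ.pullbackFun hγ g) = truncCoeff k 0 (δ.pullbackFun hδ g) := by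
  have hvalue {n : ℕ} (δ : Jet p n) (hδ : δ.LiesIn U) (c : k) :
      δ.center ∉ X.basicOpen (g - (sectionsBase p U).hom c : Γ(X, U)) ↔
        truncCoeff k 0 (δ.pullbackFun hδ g) = c := by
    rw [δ.center_mem_basicOpen_iff hδ, not_not, map_sub, δ.pullbackFun_sectionsBase hδ,
      truncCoeff_sub_algebraMap_eq_zero_iff]
  rw [← hvalue γ hγ, hγδ, hvalue δ hδ]

theorem Jet.center_eq_of_forall_truncCoeff_eq_zero {x : X} (hx : IsClosed ({x} : Set X))
    {U : X.Opens} (hU : IsAffineOpen U) {γ : Jet p m} (hγU : γ.LiesIn U)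
    (h : ∀ f : Γ(X, U), x ∉ X.basicOpen f → truncCoeff k 0 (γ.pullbackFun hγU f) = 0) :
    γ.center = x := by
  by_contra hne
  obtain ⟨f, hfx, hγf⟩ := hU.exists_basicOpen_le (V := ⟨{x}ᶜ, hx.isOpen_compl⟩)
    ⟨γ.center, hne⟩ (Jet.liesIn_iff.mp hγU)
  exact (γ.center_mem_basicOpen_iff hγU f).mp hγf (h f fun hxf ↦ hfx hxf rfl)

/-- A homomorphism `𝒪(U) → k[t]/(t^(m+1))` of `k`-algebras, as a morphism of commutative rings. -/
noncomputable def homOfSections {U : X.Opens} (φ : Sections p U →ₐ[k] Trunc k m) :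
    Γ(X, U) ⟶ CommRingCat.of (Trunc k m) :=
  CommRingCat.ofHom (R := Sections p U) φ.toRingHom

/-- The jet corresponding to a homomorphism from the coordinate ring of an affine open. -/
noncomputable def Jet.ofHom {U : X.Opens} (hU : IsAffineOpen U) (φ : Sections p U →ₐ[k] Trunc k m) :
    Jet p m where
  hom := Spec.map (homOfSections φ) ≫ hU.fromSpec
  w := by
    rw [Category.assoc, fromSpec_comp_structure, ← Spec.map_comp]
    congr 1
    ext c
    exact φ.commutes c

theorem Jet.ofHom_liesIn {U : X.Opens} (hU : IsAffineOpen U) (φ : Sections p U →ₐ[k] Trunc k m) :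
    (Jet.ofHom hU φ).LiesIn U := by
  intro s _
  have hs : (Jet.ofHom hU φ).hom s ∈ Set.range hU.fromSpec := by
    rw [Jet.ofHom, Scheme.Hom.comp_apply]
    exact ⟨_, rfl⟩
  rwa [hU.range_fromSpec] at hs

theorem Jet.pullbackFun_ofHom {U : X.Opens} (hU : IsAffineOpen U)
    (φ : Sections p U →ₐ[k] Trunc k m) (h : (Jet.ofHom hU φ).LiesIn U) (a : Γ(X, U)) :
    (Jet.ofHom hU φ).pullbackFun h a = φ a := by
  have hfrom : ⊤ ≤ hU.fromSpec ⁻¹ᵁ U := by rw [hU.fromSpec_preimage_self]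
  have hpullback : specPullback (Spec.map (homOfSections φ) ≫ hU.fromSpec) U h = homOfSections φ :=
    (specPullback_specMap_comp (homOfSections φ) _ U hfrom h).trans (by
      rw [specPullback_fromSpec, Category.id_comp])
  exact congr($hpullback a)

theorem Jet.pullbackHom_ofHom {U : X.Opens} (hU : IsAffineOpen U)
    (φ : Sections p U →ₐ[k] Trunc k m) (h : (Jet.ofHom hU φ).LiesIn U) :
    (Jet.ofHom hU φ).pullbackHom h = φ :=
  AlgHom.ext fun a ↦ Jet.pullbackFun_ofHom hU φ h a

theorem Jet.trunc_ofHom {n : ℕ} (h : n ≤ m) {U : X.Opens} (hU : IsAffineOpen U)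
    (φ : Sections p U →ₐ[k] Trunc k m) :
    (Jet.ofHom hU φ).trunc h = Jet.ofHom hU ((truncMap k h).comp φ) := by
  ext1
  refine (Category.assoc _ _ _).symm.trans (congrArg (· ≫ hU.fromSpec) ?_)
  exact (Spec.map_comp _ _).symm

end Jets

section JetsAt

variable {k : Type u} [Field k] {X : Scheme.{u}} {p : X ⟶ Spec (CommRingCat.of k)} {m : ℕ}

variable (p m) in
/-- The fibre of `X_m → X` over `x`: the set of the jets which are centred at `x`. -/
def jetsAt (x : X) : Set (Jet p m) := {γ | γ.center = x}

theorem liesIn_of_mem_jetsAt {x : X} {γ : Jet p m} (hγ : γ ∈ jetsAt p m x) {U : X.Opens}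
    (hxU : x ∈ U) : γ.LiesIn U :=
  Jet.liesIn_iff.mpr (Eq.symm hγ ▸ hxU)

theorem Jet.isOpen_basicOpen {U : X.Opens} (hU : IsAffineOpen U)
    (F : MvPolynomial (Γ(X, U) × Fin (m + 1)) k) : IsOpen (Jet.basicOpen p m U F) :=
  GenerateOpen.basic _ ⟨U, F, hU, rfl⟩

theorem isClosed_jetsAt {x : X} (hx : IsClosed ({x} : Set X)) : IsClosed (jetsAt p m x) := by
  rw [← isOpen_compl_iff, isOpen_iff_forall_mem_open]
  intro γ hγ
  obtain ⟨W, hW, hγW, hWx⟩ := exists_isAffineOpen_mem_and_subset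
    (U := ⟨{x}ᶜ, hx.isOpen_compl⟩) (show γ.center ∈ _ from hγ)
  refine ⟨Jet.basicOpen p m W 1, ?_, Jet.isOpen_basicOpen hW 1, ⟨Jet.liesIn_iff.mpr hγW, by simp⟩⟩
  rintro δ ⟨hδ, -⟩
  exact hWx (Jet.liesIn_iff.mp hδ)

theorem exists_pullbackFun_mul_eq_one {x : X} {U : X.Opens} {f : Γ(X, U)}
    (hf : x ∈ X.basicOpen f) :
    ∃ e : Γ(X, U), ∀ γ (hγ : γ ∈ jetsAt p m x),
      γ.pullbackFun (liesIn_of_mem_jetsAt hγ (X.basicOpen_le f hf)) e *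
        γ.pullbackFun (liesIn_of_mem_jetsAt hγ (X.basicOpen_le f hf)) f = 1 := by
  rcases (jetsAt p m x).eq_empty_or_nonempty with hempty | ⟨γ₀, hγ₀⟩
  · exact ⟨0, fun γ hγ ↦ by simp [hempty] at hγ⟩
  have hγ₀U : γ₀.LiesIn U := liesIn_of_mem_jetsAt hγ₀ (X.basicOpen_le f hf)
  have hunit : truncCoeff k 0 (γ₀.pullbackFun hγ₀U f) ≠ 0 :=
    (γ₀.center_mem_basicOpen_iff hγ₀U f).mp (Eq.symm hγ₀ ▸ hf)
  obtain ⟨e, he⟩ := exists_forall_mul_eq_one (B := Sections p U) (m := m) f hunit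
  exact ⟨e, fun γ hγ ↦ he (γ.pullbackHom _)
    (Jet.truncCoeff_zero_eq_of_center_eq (hγ.trans hγ₀.symm) _ hγ₀U f)⟩

theorem exists_pullbackFun_eq {x : X} {U V : X.Opens} (hU : IsAffineOpen U) (hxU : x ∈ U)
    (hxV : x ∈ V) (b : Γ(X, V)) : ∃ a : Γ(X, U), ∀ γ (hγ : γ ∈ jetsAt p m x),
      γ.pullbackFun (liesIn_of_mem_jetsAt hγ hxV) b =
        γ.pullbackFun (liesIn_of_mem_jetsAt hγ hxU) a := by
  obtain ⟨f, hfV, hxf⟩ := hU.exists_basicOpen_le (V := V) ⟨x, hxV⟩ hxU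
  have := hU.isLocalization_basicOpen f
  obtain ⟨n, a, ha⟩ := IsLocalization.Away.surj f (X.presheaf.map (homOfLE hfV).op b)
  obtain ⟨e, he⟩ := exists_pullbackFun_mul_eq_one (p := p) (m := m) hxf
  refine ⟨a * e ^ n, fun γ hγ ↦ ?_⟩
  have hγU := liesIn_of_mem_jetsAt hγ hxU
  have hγV := liesIn_of_mem_jetsAt hγ hxV
  have hγf := liesIn_of_mem_jetsAt hγ hxf
  have hef : γ.pullbackFun hγU e * γ.pullbackFun hγU f = 1 := he γ hγ
  have hb : γ.pullbackFun hγV b * γ.pullbackFun hγU f ^ n = γ.pullbackFun hγU a := by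
    have hmap := congrArg (γ.pullbackFun hγf) ha
    rw [map_mul, map_pow, γ.pullbackFun_map hfV hγf hγV] at hmap
    rw [← γ.pullbackFun_map (X.basicOpen_le f) hγf hγU f,
      ← γ.pullbackFun_map (X.basicOpen_le f) hγf hγU a]
    exact hmap
  rw [map_mul, map_pow, ← hb, mul_assoc, ← mul_pow, mul_comm (γ.pullbackFun hγU f), hef, one_pow,
    mul_one]

/-- For a set `S` of jets which are centred at a point of `U`, the family of the pullbacks of the
sections over `U` along the members of `S`. -/
noncomputable def jetEval {x : X} {U : X.Opens} (hxU : x ∈ U) {S : Set (Jet p m)}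
    (hS : S ⊆ jetsAt p m x) (γ : S) : Sections p U →ₐ[k] Trunc k m :=
  γ.1.pullbackHom (liesIn_of_mem_jetsAt (hS γ.2) hxU)

end JetsAt

section JetsAtTopology

variable {k : Type u} [Field k] {X : Scheme.{u}} {p : X ⟶ Spec (CommRingCat.of k)} {m : ℕ} {x : X}
  {U : X.Opens}

theorem Jet.mem_basicOpen_iff (hxU : x ∈ U) {S : Set (Jet p m)} (hS : S ⊆ jetsAt p m x) (γ : S)
    (F : MvPolynomial (Sections p U × Fin (m + 1)) k) :
    γ.1 ∈ Jet.basicOpen p m U F ↔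
      MvPolynomial.eval (fun a ↦ truncCoeff k a.2 (jetEval hxU hS γ a.1)) F ≠ 0 :=
  ⟨fun ⟨_, h⟩ ↦ h, fun h ↦ ⟨_, h⟩⟩

theorem exists_basicOpen_inter_jetsAt_eq (hU : IsAffineOpen U) (hxU : x ∈ U) {V : X.Opens}
    (hxV : x ∈ V) (F : MvPolynomial (Γ(X, V) × Fin (m + 1)) k) :
    ∃ G : MvPolynomial (Γ(X, U) × Fin (m + 1)) k,
      Jet.basicOpen p m U G ∩ jetsAt p m x = Jet.basicOpen p m V F ∩ jetsAt p m x := by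
  choose a ha using exists_pullbackFun_eq (p := p) (m := m) hU hxU hxV
  have heval (δ : Jet p m) (hδ : δ ∈ jetsAt p m x) :
      MvPolynomial.eval (fun b ↦ truncCoeff k b.2
        (δ.pullbackFun (liesIn_of_mem_jetsAt hδ hxU) b.1)) (MvPolynomial.rename (Prod.map a id) F) =
      MvPolynomial.eval (fun b ↦ truncCoeff k b.2
        (δ.pullbackFun (liesIn_of_mem_jetsAt hδ hxV) b.1)) F := by
    rw [MvPolynomial.eval_rename]
    congr 2
    ext b
    exact congrArg (truncCoeff k b.2) (ha b.1 δ hδ).symm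
  refine ⟨MvPolynomial.rename (Prod.map a id) F, Set.ext fun δ ↦ and_congr_left fun hδ ↦ ?_⟩
  exact ⟨fun ⟨_, h⟩ ↦ ⟨liesIn_of_mem_jetsAt hδ hxV, heval δ hδ ▸ h⟩,
    fun ⟨_, h⟩ ↦ ⟨liesIn_of_mem_jetsAt hδ hxU, (heval δ hδ).symm ▸ h⟩⟩

theorem Jet.basicOpen_mul (F G : MvPolynomial (Γ(X, U) × Fin (m + 1)) k) :
    Jet.basicOpen p m U (F * G) = Jet.basicOpen p m U F ∩ Jet.basicOpen p m U G := by
  ext δ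
  refine ⟨fun ⟨hδ, h⟩ ↦ ?_, fun ⟨⟨hδ, h⟩, ⟨_, h'⟩⟩ ↦ ?_⟩
  · rw [map_mul] at h
    exact ⟨⟨hδ, left_ne_zero_of_mul h⟩, hδ, right_ne_zero_of_mul h⟩
  · exact ⟨hδ, by rw [map_mul]; exact mul_ne_zero h h'⟩

theorem exists_basicOpen_inter_jetsAt_subset (hU : IsAffineOpen U) (hxU : x ∈ U)
    {O : Set (Jet p m)} (hO : IsOpen O) {γ : Jet p m} (hγ : γ ∈ O ∩ jetsAt p m x) :
    ∃ F : MvPolynomial (Γ(X, U) × Fin (m + 1)) k, γ ∈ Jet.basicOpen p m U F ∩ jetsAt p m x ∧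
      Jet.basicOpen p m U F ∩ jetsAt p m x ⊆ O := by
  obtain ⟨hγO, hγx⟩ := hγ
  induction hO with
  | basic O hO =>
    obtain ⟨V, F, -, rfl⟩ := hO
    obtain ⟨hγV, -⟩ := id hγO
    have hxV : x ∈ V := (show γ.center = x from hγx) ▸ Jet.liesIn_iff.mp hγV
    obtain ⟨G, hG⟩ := exists_basicOpen_inter_jetsAt_eq (p := p) hU hxU hxV F
    exact ⟨G, hG ▸ ⟨hγO, hγx⟩, hG ▸ Set.inter_subset_left⟩
  | univ => exact ⟨1, ⟨⟨liesIn_of_mem_jetsAt hγx hxU, by simp⟩, hγx⟩, Set.subset_univ _⟩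
  | inter O O' _ _ ih ih' =>
    obtain ⟨F, hF, hFO⟩ := ih hγO.1
    obtain ⟨F', hF', hFO'⟩ := ih' hγO.2
    refine ⟨F * F', ?_⟩
    rw [Jet.basicOpen_mul, Set.inter_inter_distrib_right]
    exact ⟨⟨hF, hF'⟩, Set.inter_subset_inter hFO hFO'⟩
  | sUnion S _ ih =>
    obtain ⟨O, hO, hγ⟩ := hγO
    obtain ⟨F, hF, hFO⟩ := ih O hO hγ
    exact ⟨F, hF, hFO.trans (Set.subset_sUnion_of_mem hO)⟩

variable {S : Set (Jet p m)}

theorem isTopologicalBasis_coordAlg_jetEval (hU : IsAffineOpen U) (hxU : x ∈ U)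
    (hS : S ⊆ jetsAt p m x) :
    IsTopologicalBasis
      (Set.range fun f : coordAlg (jetEval hxU hS) ↦ {γ | (f : S → k) γ ≠ 0}) := by
  refine isTopologicalBasis_of_isOpen_of_nhds ?_ ?_
  · rintro _ ⟨⟨f, hf⟩, rfl⟩
    obtain ⟨F, rfl⟩ := (mem_coordAlg_iff f).mp hf
    simp_rw [← Jet.mem_basicOpen_iff]
    exact (Jet.isOpen_basicOpen hU F).preimage continuous_subtype_val
  · rintro γ _ hγO ⟨O, hO, rfl⟩
    obtain ⟨F, hγF, hFO⟩ := exists_basicOpen_inter_jetsAt_subset hU hxU hO ⟨hγO, hS γ.2⟩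
    refine ⟨_, ⟨⟨_, (mem_coordAlg_iff _).mpr ⟨F, rfl⟩⟩, rfl⟩,
      (Jet.mem_basicOpen_iff hxU hS γ F).mp hγF.1, fun δ hδ ↦ hFO ⟨?_, hS δ.2⟩⟩
    exact (Jet.mem_basicOpen_iff hxU hS δ F).mpr hδ

theorem ringKrullDim_coordAlg_closure (hU : IsAffineOpen U) (hxU : x ∈ U)
    (hS : S ⊆ jetsAt p m x) (hS' : closure S ⊆ jetsAt p m x) :
    ringKrullDim (coordAlg (jetEval hxU hS)) = ringKrullDim (coordAlg (jetEval hxU hS')) := by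
  have hdense : DenseRange (Set.inclusion (subset_closure : S ⊆ closure S)) :=
    denseRange_inclusion_iff subset_closure |>.mpr subset_rfl
  refine ringKrullDim_coordAlg_comp (ev := jetEval hxU hS') (Set.inclusion subset_closure)
    fun f hf hfS ↦ ?_
  by_contra hne
  obtain ⟨t, ht⟩ := Function.ne_iff.mp hne
  have hopen : IsOpen {t | f t ≠ 0} :=
    (isTopologicalBasis_coordAlg_jetEval hU hxU hS').isOpen ⟨⟨f, hf⟩, rfl⟩
  obtain ⟨s, hs⟩ := hdense.exists_mem_open hopen ⟨t, ht⟩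
  exact hs (congrFun hfS s)

theorem center_ofHom_arcOfPoint (hx : IsClosed ({x} : Set X)) (hU : IsAffineOpen U) (hxU : x ∈ U)
    (hS : S ⊆ jetsAt p m x) (φ : coordAlg (jetEval hxU hS) →ₐ[k] k) :
    (Jet.ofHom hU (arcOfPoint φ)).center = x := by
  refine Jet.center_eq_of_forall_truncCoeff_eq_zero hx hU (Jet.ofHom_liesIn hU _) fun f hf ↦ ?_
  have hzero : coordElem (jetEval hxU hS) f 0 = 0 := by
    ext γ
    by_contra h
    have hγf := (γ.1.center_mem_basicOpen_iff (liesIn_of_mem_jetsAt (hS γ.2) hxU) f).mpr h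
    exact hf ((show γ.1.center = x from hS γ.2) ▸ hγf)
  rw [Jet.pullbackFun_ofHom]
  exact (truncCoeff_arcOfPoint φ f 0).trans (hzero ▸ map_zero φ)

theorem ofHom_arcOfPoint_mem_closure (hx : IsClosed ({x} : Set X)) (hU : IsAffineOpen U)
    (hxU : x ∈ U) (hS : S ⊆ jetsAt p m x) (φ : coordAlg (jetEval hxU hS) →ₐ[k] k) :
    Jet.ofHom hU (arcOfPoint φ) ∈ closure S := by
  by_contra hmem
  obtain ⟨F, ⟨⟨h, hF⟩, -⟩, hFS⟩ := exists_basicOpen_inter_jetsAt_subset hU hxU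
    isClosed_closure.isOpen_compl ⟨hmem, center_ofHom_arcOfPoint hx hU hxU hS φ⟩
  simp only [Jet.pullbackFun_ofHom] at hF
  refine hF ((eval_truncCoeff_arcOfPoint φ F 0 fun γ ↦ ?_).trans (map_zero φ))
  by_contra hγ
  exact hFS ⟨(Jet.mem_basicOpen_iff hxU hS γ F).mpr (Ne.symm hγ), hS γ.2⟩ (subset_closure γ.2)

theorem exists_forall_apply_eq_of_isClosed (hx : IsClosed ({x} : Set X)) (hU : IsAffineOpen U)
    (hxU : x ∈ U) (hS : S ⊆ jetsAt p m x) (hS' : IsClosed S)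
    (φ : coordAlg (jetEval hxU hS) →ₐ[k] k) :
    ∃ γ, ∀ f : coordAlg (jetEval hxU hS), φ f = (f : S → k) γ := by
  refine ⟨⟨_, hS'.closure_subset (ofHom_arcOfPoint_mem_closure hx hU hxU hS φ)⟩, fun f ↦ ?_⟩
  obtain ⟨F, hF⟩ := (mem_coordAlg_iff _).mp f.2
  rw [← eval_truncCoeff_arcOfPoint φ F f (congrFun hF), hF]
  simp only [jetEval, Jet.pullbackHom_ofHom]

theorem topologicalKrullDim_closure_eq [IsAlgClosed k] [LocallyOfFiniteType p]
    (hx : IsClosed ({x} : Set X)) (hU : IsAffineOpen U) (hxU : x ∈ U) (hS : S ⊆ jetsAt p m x) :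
    topologicalKrullDim (closure S) = ringKrullDim (coordAlg (jetEval hxU hS)) := by
  have hcl : closure S ⊆ jetsAt p m x := closure_minimal hS (isClosed_jetsAt hx)
  have := finiteType_sections p hU
  rw [ringKrullDim_coordAlg_closure hU hxU hS hcl]
  exact topologicalKrullDim_eq_ringKrullDim_of_isTopologicalBasis
    (isTopologicalBasis_coordAlg_jetEval hU hxU hcl)
    (exists_forall_apply_eq_of_isClosed hx hU hxU hcl isClosed_closure)

end JetsAtTopology

section EtaleLift

variable {P B R C : Type*} [CommRing P] [CommRing B] [Algebra P B] [CommRing R] [CommRing C]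

theorem exists_ringHom_lift_of_formallySmooth [Algebra.FormallySmooth P B] {r : R →+* C}
    (hr : Function.Surjective r) (hn : IsNilpotent (RingHom.ker r)) (f : P →+* R) (e : B →+* C)
    (h : r.comp f = e.comp (algebraMap P B)) :
    ∃ g : B →+* R, g.comp (algebraMap P B) = f ∧ r.comp g = e := by
  let := f.toAlgebra
  let := (e.comp (algebraMap P B)).toAlgebra
  let e' : B →ₐ[P] C := { e with commutes' := fun _ ↦ rfl }
  let r' : R →ₐ[P] C := { r with commutes' := fun a ↦ congr($h a) }
  let g := Algebra.FormallySmooth.liftOfSurjective e' r' hr hn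
  refine ⟨g.toRingHom, RingHom.ext fun a ↦ g.commutes a, RingHom.ext fun b ↦ ?_⟩
  exact Algebra.FormallySmooth.liftOfSurjective_apply e' r' hr hn b

theorem ringHom_eq_of_formallyUnramified [Algebra.FormallyUnramified P B] {r : R →+* C}
    (hn : IsNilpotent (RingHom.ker r)) {g₁ g₂ : B →+* R}
    (h : g₁.comp (algebraMap P B) = g₂.comp (algebraMap P B)) (h' : r.comp g₁ = r.comp g₂) :
    g₁ = g₂ := by
  let := (g₁.comp (algebraMap P B)).toAlgebra
  let g₁' : B →ₐ[P] R := { g₁ with commutes' := fun _ ↦ rfl }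
  let g₂' : B →ₐ[P] R := { g₂ with commutes' := fun a ↦ congr($h.symm a) }
  have := Algebra.FormallyUnramified.ext' r hn g₁' g₂' fun b ↦ congr($h' b)
  exact congr(AlgHom.toRingHom $this)

theorem exists_ringHom_quotient_ker_pow [Algebra.FormallySmooth P B] {e : B →+* C} {f : P →+* C}
    (hef : e.comp (algebraMap P B) = f) (hf : Function.Surjective f) (N : ℕ) :
    ∃ s : B →+* P ⧸ RingHom.ker f ^ (N + 1), s.comp (algebraMap P B) = Ideal.Quotient.mk _ ∧
      (Ideal.Quotient.lift (RingHom.ker f ^ (N + 1)) f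
        fun _ ha ↦ Ideal.pow_le_self N.succ_ne_zero ha).comp s = e := by
  refine exists_ringHom_lift_of_formallySmooth (Ideal.Quotient.lift_surjective_of_surjective _ _ hf)
    ⟨N + 1, ?_⟩ _ e (hef ▸ RingHom.ext fun _ ↦ rfl)
  rw [Ideal.ker_quotient_lift, ← Ideal.map_pow, Ideal.map_quotient_self, Ideal.zero_eq_bot]

theorem exists_forall_apply_eq_apply_algebraMap [Algebra.FormallyEtale P B] {r : R →+* C}
    (hn : IsNilpotent (RingHom.ker r)) {e : B →+* C}
    (he : Function.Surjective (e.comp (algebraMap P B))) (b : B) :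
    ∃ F : P, ∀ φ : B →+* R, r.comp φ = e → φ b = φ (algebraMap P B F) := by
  obtain ⟨N, hN⟩ := hn
  obtain ⟨s, hs, hs'⟩ := exists_ringHom_quotient_ker_pow rfl he N
  obtain ⟨F, hF⟩ := Ideal.Quotient.mk_surjective (s b)
  refine ⟨F, fun φ hφ ↦ ?_⟩
  let f : P →+* R := φ.comp (algebraMap P B)
  have hf (a : P) (ha : a ∈ RingHom.ker (e.comp (algebraMap P B)) ^ (N + 1)) : f a = 0 := by
    have hker : RingHom.ker (e.comp (algebraMap P B)) ≤ (RingHom.ker r).comap f :=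
      fun a ha ↦ (congr($hφ (algebraMap P B a))).trans ha
    have hpow := (Ideal.pow_right_mono hker (N + 1)).trans (Ideal.le_comap_pow f (N + 1)) ha
    rwa [pow_succ, hN, zero_mul] at hpow
  have hlift : r.comp (Ideal.Quotient.lift _ f hf) = Ideal.Quotient.lift _ _
      fun _ ha ↦ Ideal.pow_le_self N.succ_ne_zero ha :=
    Ideal.Quotient.ringHom_ext (RingHom.ext fun a ↦ congr($hφ (algebraMap P B a)))
  have hφs : φ = (Ideal.Quotient.lift _ f hf).comp s := by
    refine ringHom_eq_of_formallyUnramified (P := P) ⟨N, hN⟩ ?_ ?_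
    · rw [RingHom.comp_assoc, hs]
      exact RingHom.ext fun _ ↦ rfl
    · rw [← RingHom.comp_assoc, hlift, hφ, hs']
  rw [hφs, RingHom.comp_apply, ← hF, RingHom.comp_apply, ← RingHom.comp_apply s, hs]

end EtaleLift

section EtaleCoordinates

variable {k : Type u} [Field k]

theorem isNilpotent_ker_truncResidue (m : ℕ) :
    IsNilpotent (RingHom.ker (truncResidue k m : Trunc k m →+* k)) := by
  refine ⟨m + 1, ?_⟩
  have hker : RingHom.ker (truncResidue k m : Trunc k m →+* k) ≤
      Ideal.span {AdjoinRoot.root (Polynomial.X ^ (m + 1))} := by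
    intro a ha
    obtain ⟨f, rfl⟩ := AdjoinRoot.mk_surjective a
    rw [Ideal.mem_span_singleton, ← AdjoinRoot.mk_X]
    exact map_dvd _ (Polynomial.X_dvd_iff.mpr ((truncCoeff_mk 0 f).symm.trans ha))
  refine le_bot_iff.mp ((Ideal.pow_right_mono hker _).trans ?_)
  rw [Ideal.span_singleton_pow, ← AdjoinRoot.mk_X, ← map_pow, AdjoinRoot.mk_self,
    Ideal.span_singleton_zero]

theorem truncResidue_surjective (m : ℕ) :
    Function.Surjective (truncResidue k m : Trunc k m →+* k) :=
  fun c ↦ ⟨algebraMap k _ c, (truncResidue k m).commutes c⟩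

variable {B : Type*} [CommRing B] [Algebra k B] {σ : Type*} [Algebra (MvPolynomial σ k) B]
  [IsScalarTower k (MvPolynomial σ k) B]

theorem comp_algebraMap_mvPolynomial_eq {A : Type*} [CommRing A] [Algebra k A] (φ : B →ₐ[k] A) :
    (φ : B →+* A).comp (algebraMap (MvPolynomial σ k) B) =
      (MvPolynomial.aeval fun i ↦ φ (algebraMap (MvPolynomial σ k) B (.X i)) :
        MvPolynomial σ k →ₐ[k] A) :=
  congrArg AlgHom.toRingHom <|
    MvPolynomial.aeval_unique (φ.comp (IsScalarTower.toAlgHom k (MvPolynomial σ k) B))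

theorem exists_algHom_trunc_of_formallySmooth [Algebra.FormallySmooth (MvPolynomial σ k) B]
    (ε : B →ₐ[k] k) {m : ℕ} {c : σ → Trunc k m}
    (hc : ∀ i, truncCoeff k 0 (c i) = ε (algebraMap (MvPolynomial σ k) B (.X i))) :
    ∃ φ : B →ₐ[k] Trunc k m, (∀ i, φ (algebraMap (MvPolynomial σ k) B (.X i)) = c i) ∧
      ∀ b, truncCoeff k 0 (φ b) = ε b := by
  obtain ⟨g, hg, hgε⟩ := exists_ringHom_lift_of_formallySmooth (P := MvPolynomial σ k)
    (truncResidue_surjective m) (isNilpotent_ker_truncResidue m)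
    (MvPolynomial.aeval c : MvPolynomial σ k →ₐ[k] Trunc k m).toRingHom (ε : B →+* k) (by
      rw [comp_algebraMap_mvPolynomial_eq, ← funext hc]
      exact congrArg AlgHom.toRingHom (MvPolynomial.comp_aeval c (truncResidue k m)))
  refine ⟨{ g with commutes' := fun a ↦ ?_ }, fun i ↦ ?_, fun b ↦ congr($hgε b)⟩
  · rw [IsScalarTower.algebraMap_apply k (MvPolynomial σ k) B]
    exact congr($hg (.C a)).trans (MvPolynomial.aeval_C _ _)
  · exact congr($hg (.X i)).trans (MvPolynomial.aeval_X _ _)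

theorem algHom_trunc_ext_of_formallyUnramified [Algebra.FormallyUnramified (MvPolynomial σ k) B]
    {m : ℕ} {φ ψ : B →ₐ[k] Trunc k m}
    (h : ∀ i, φ (algebraMap (MvPolynomial σ k) B (.X i)) =
      ψ (algebraMap (MvPolynomial σ k) B (.X i)))
    (h' : ∀ b, truncCoeff k 0 (φ b) = truncCoeff k 0 (ψ b)) : φ = ψ := by
  refine AlgHom.coe_ringHom_injective <|
    ringHom_eq_of_formallyUnramified (P := MvPolynomial σ k) (isNilpotent_ker_truncResidue m) ?_
      (RingHom.ext h')
  rw [comp_algebraMap_mvPolynomial_eq, comp_algebraMap_mvPolynomial_eq, funext h]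

theorem exists_mvPolynomial_forall_algHom_trunc_eq [Algebra.FormallyEtale (MvPolynomial σ k) B]
    (ε : B →ₐ[k] k) (m : ℕ) (b : B) : ∃ F : MvPolynomial σ k, ∀ φ : B →ₐ[k] Trunc k m,
      (∀ b, truncCoeff k 0 (φ b) = ε b) → φ b = φ (algebraMap _ B F) := by
  have hε : Function.Surjective
      ((ε : B →+* k).comp (algebraMap (MvPolynomial σ k) B)) := fun c ↦ ⟨.C c, by
    rw [comp_algebraMap_mvPolynomial_eq]
    exact MvPolynomial.aeval_C _ c⟩
  obtain ⟨F, hF⟩ := exists_forall_apply_eq_apply_algebraMap (isNilpotent_ker_truncResidue m) hε b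
  exact ⟨F, fun φ hφ ↦ hF φ (RingHom.ext hφ)⟩

theorem algebraMap_mem_adjoin_range_X (F : MvPolynomial σ k) : algebraMap (MvPolynomial σ k) B F ∈
    Algebra.adjoin k (Set.range fun i ↦ algebraMap (MvPolynomial σ k) B (.X i)) := by
  rw [Algebra.adjoin_range_eq_range_aeval]
  exact ⟨F, congr($(comp_algebraMap_mvPolynomial_eq (AlgHom.id k B)) F).symm⟩

theorem exists_compatible_algHom_trunc_of_etale [Algebra.FormallyEtale (MvPolynomial σ k) B]
    (ε : B →ₐ[k] k) {f : σ → Polynomial k}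
    (hf : ∀ i, (f i).coeff 0 = ε (algebraMap (MvPolynomial σ k) B (.X i))) :
    ∃ φ : ∀ j, B →ₐ[k] Trunc k j, (∀ i j (h : i ≤ j), (truncMap k h).comp (φ j) = φ i) ∧
      (∀ j b, truncCoeff k 0 (φ j b) = ε b) ∧
      ∀ j i, φ j (algebraMap (MvPolynomial σ k) B (.X i)) = AdjoinRoot.mk _ (f i) := by
  choose φ hφ hφε using fun j ↦ exists_algHom_trunc_of_formallySmooth (σ := σ) ε
    (c := fun i ↦ AdjoinRoot.mk (Polynomial.X ^ (j + 1)) (f i))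
    fun i ↦ (truncCoeff_mk 0 (f i)).trans (hf i)
  refine ⟨φ, fun i j h ↦ ?_, hφε, hφ⟩
  refine algHom_trunc_ext_of_formallyUnramified (σ := σ) (fun l ↦ ?_) fun b ↦ ?_
  · rw [AlgHom.comp_apply, hφ, hφ, truncMap_mk]
  · rw [AlgHom.comp_apply, truncCoeff_truncMap, hφε]
    exact hφε j b

theorem ringKrullDim_coordAlg_of_etale [Infinite k] [Finite σ]
    [Algebra.FormallyEtale (MvPolynomial σ k) B] (ε : B →ₐ[k] k) {m : ℕ} {S : Type*}
    (ev : S → (B →ₐ[k] Trunc k m)) (hε : ∀ s b, truncCoeff k 0 (ev s b) = ε b)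
    (hsurj : ∀ φ : (∀ j, B →ₐ[k] Trunc k j),
      (∀ i j (h : i ≤ j), (truncMap k h).comp (φ j) = φ i) →
      (∀ j b, truncCoeff k 0 (φ j b) = ε b) → ∃ s, ev s = φ m) :
    ringKrullDim (coordAlg ev) = (Nat.card σ * m : ℕ) := by
  refine ringKrullDim_coordAlg_of_coordinates
    (x := fun i ↦ algebraMap (MvPolynomial σ k) B (.X i)) (fun i ↦ ⟨_, fun s ↦ hε s _⟩)
    (fun b ↦ ?_) fun c ↦ ?_
  · obtain ⟨F, hF⟩ := exists_mvPolynomial_forall_algHom_trunc_eq (σ := σ) ε m b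
    exact ⟨_, algebraMap_mem_adjoin_range_X F, fun s ↦ hF (ev s) (hε s)⟩
  · let f (i : σ) : Polynomial k := .C (ε (algebraMap (MvPolynomial σ k) B (.X i))) +
      ∑ j : Fin m, .monomial (j + 1) (c (i, j))
    obtain ⟨φ, hcomp, hφε, hφ⟩ := exists_compatible_algHom_trunc_of_etale (σ := σ) ε (f := f)
      fun i ↦ by simp [f, Polynomial.coeff_monomial]
    obtain ⟨s, hs⟩ := hsurj φ hcomp hφε
    refine ⟨s, fun i j ↦ ?_⟩
    rw [hs, hφ, truncCoeff_mk]
    simp [f, Polynomial.coeff_monomial, Fin.val_inj]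

end EtaleCoordinates

section Functoriality

variable {k : Type u} [Field k] {X Z : Scheme.{u}} {p : X ⟶ Spec (CommRingCat.of k)}
  {r : Z ⟶ Spec (CommRingCat.of k)} {m : ℕ}

theorem sectionsBase_appLE (f : Z ⟶ X) (hf : f ≫ p = r) {U : X.Opens} {W : Z.Opens}
    (h : W ≤ f ⁻¹ᵁ U) : sectionsBase p U ≫ f.appLE U W h = sectionsBase r W := by
  subst hf
  rw [sectionsBase, Category.assoc, Scheme.Hom.appLE_comp_appLE, sectionsBase]

/-- The pullback of sections along a morphism over `k`, as a homomorphism of `k`-algebras. -/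
noncomputable def sectionsPullback (f : Z ⟶ X) (hf : f ≫ p = r) {U : X.Opens} {W : Z.Opens}
    (h : W ≤ f ⁻¹ᵁ U) : Sections p U →ₐ[k] Sections r W where
  __ := ((f.appLE U W h).hom : Γ(X, U) →+* Γ(Z, W))
  commutes' c := congr($(sectionsBase_appLE f hf h) c)

/-- The image of a jet under a morphism over `k`. -/
noncomputable def Jet.map (f : Z ⟶ X) (hf : f ≫ p = r) (γ : Jet r m) : Jet p m where
  hom := γ.hom ≫ f
  w := by rw [Category.assoc, hf, γ.w]

theorem Jet.center_map (f : Z ⟶ X) (hf : f ≫ p = r) (γ : Jet r m) :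
    (γ.map f hf).center = f γ.center :=
  Scheme.Hom.comp_apply _ _ _

theorem Jet.pullbackFun_map_eq (f : Z ⟶ X) (hf : f ≫ p = r) {U : X.Opens} {W : Z.Opens}
    (h : W ≤ f ⁻¹ᵁ U) (γ : Jet r m) (hW : γ.LiesIn W) (hU : (γ.map f hf).LiesIn U) (a : Γ(X, U)) :
    (γ.map f hf).pullbackFun hU a = γ.pullbackFun hW (f.appLE U W h a) :=
  congr($((appLE_comp_specPullback γ.hom f h hW hU).symm) a)

/-- The image of an arc under a morphism over `k`. -/
noncomputable def Arc.map (f : Z ⟶ X) (hf : f ≫ p = r) (γ : Arc r) : Arc p where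
  jet m := (γ.jet m).map f hf
  compat n m h := by
    rw [← γ.compat n m h]
    ext1
    exact (Category.assoc _ _ _).symm

end Functoriality

section Arcs

variable {k : Type u} [Field k] {X Z : Scheme.{u}} {p : X ⟶ Spec (CommRingCat.of k)}
  {r : Z ⟶ Spec (CommRingCat.of k)} {x : X} {m : ℕ}

theorem mem_arcFiber_iff {γ : Arc p} : γ ∈ arcFiber p x ↔ (γ.jet 0).center = x :=
  ⟨fun h ↦ h _, fun h s ↦ ((γ.jet 0).hom_apply s).trans h⟩

theorem Arc.center_jet (γ : Arc p) (m : ℕ) : (γ.jet m).center = (γ.jet 0).center := by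
  rw [← γ.compat 0 m (Nat.zero_le m), Jet.center_trunc]

theorem jetImage_subset_jetsAt (x : X) (m : ℕ) : jetImage p x m ⊆ jetsAt p m x := by
  rintro _ ⟨γ, hγ, rfl⟩
  exact (γ.center_jet m).trans (mem_arcFiber_iff.mp hγ)

theorem map_mem_jetImage (f : Z ⟶ X) (hf : f ≫ p = r) {z : Z} {γ : Jet r m}
    (hγ : γ ∈ jetImage r z m) : γ.map f hf ∈ jetImage p (f z) m := by
  obtain ⟨α, hα, rfl⟩ := hγ
  refine ⟨α.map f hf, mem_arcFiber_iff.mpr ?_, rfl⟩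
  exact ((α.jet 0).center_map f hf).trans (congrArg f (mem_arcFiber_iff.mp hα))

/-- The constant arc at a `k`-point. -/
noncomputable def Arc.const (σ : Spec (CommRingCat.of k) ⟶ X) (hσ : σ ≫ p = 𝟙 _) : Arc p where
  jet m :=
    { hom := Spec.map (CommRingCat.ofHom (algebraMap k (Trunc k m))) ≫ σ
      w := by rw [Category.assoc, hσ, Category.comp_id] }
  compat n m h := by
    ext1
    refine (Category.assoc _ _ _).symm.trans (congrArg (· ≫ σ) ?_)
    rw [← Spec.map_comp, ← CommRingCat.ofHom_comp]
    congr 2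
    exact (truncMap k h).comp_algebraMap

variable (p) in
theorem jetImage_nonempty [IsAlgClosed k] [LocallyOfFiniteType p] (hx : IsClosed ({x} : Set X))
    (m : ℕ) : (jetImage p x m).Nonempty := by
  refine ⟨_, Arc.const (pointOfClosedPoint p x hx) (pointOfClosedPoint_comp p x hx), fun s ↦ ?_,
    rfl⟩
  exact (Scheme.Hom.comp_apply _ _ s).trans (pointOfClosedPoint_apply p x hx _)

/-- The arc corresponding to a compatible family of homomorphisms from the coordinate ring of an
affine open. -/
noncomputable def Arc.ofHom {U : X.Opens} (hU : IsAffineOpen U)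
    (φ : ∀ m, Sections p U →ₐ[k] Trunc k m)
    (h : ∀ n m (h : n ≤ m), (truncMap k h).comp (φ m) = φ n) : Arc p where
  jet m := Jet.ofHom hU (φ m)
  compat n m hnm := by rw [Jet.trunc_ofHom, h]

theorem topologicalKrullDim_closure_jetImage_eq_dim [IsAlgClosed k] [LocallyOfFiniteType p]
    (hx : IsClosed ({x} : Set X)) (m : ℕ) :
    topologicalKrullDim (closure (jetImage p x m)) = dim (closure (jetImage p x m)) := by
  obtain ⟨U, hU, hxU, -⟩ := exists_isAffineOpen_mem_and_subset (U := ⊤) (show x ∈ _ from trivial)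
  have := finiteType_sections p hU
  have := (jetImage_nonempty p hx m).to_subtype
  obtain ⟨d, hd⟩ := exists_ringKrullDim_eq_natCast k
    (coordAlg (jetEval (p := p) hxU (jetImage_subset_jetsAt x m)))
  rw [← topologicalKrullDim_closure_eq hx hU hxU] at hd
  rw [dim_eq_of_topologicalKrullDim_eq hd, hd]

end Arcs

section SmoothPoints

variable {k : Type u} [Field k] {X : Scheme.{u}} {p : X ⟶ Spec (CommRingCat.of k)} {x : X}

theorem exists_isStandardSmooth_sectionsBase [LocallyOfFinitePresentation p]
    (hx : x ∈ p.smoothLocus) :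
    ∃ U : X.Opens, IsAffineOpen U ∧ x ∈ U ∧ (sectionsBase p U).hom.IsStandardSmooth := by
  have : Smooth (p.smoothLocus.ι ≫ p) := by
    rw [← Scheme.Hom.smoothLocus_eq_top_iff, ← Scheme.Hom.preimage_smoothLocus_eq]
    simp
  obtain ⟨T, hT, V, hV, hxV, e, he⟩ :=
    Smooth.exists_isStandardSmooth (p.smoothLocus.ι ≫ p) ⟨x, hx⟩
  obtain rfl : T = ⊤ := by
    refine top_unique fun s _ ↦ ?_
    rw [Subsingleton.elim s]
    exact e hxV
  refine ⟨p.smoothLocus.ι ''ᵁ V, hV.image_of_isOpenImmersion _, ⟨_, hxV, rfl⟩, ?_⟩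
  have hbase : sectionsBase p (p.smoothLocus.ι ''ᵁ V) =
      sectionsBase (p.smoothLocus.ι ≫ p) V ≫ (p.smoothLocus.ι.appIso V).inv := by
    rw [← sectionsBase_appLE p.smoothLocus.ι rfl (p.smoothLocus.ι.preimage_image_eq V).ge,
      Category.assoc, Scheme.Hom.appLE_appIso_inv]
    exact (sectionsBase_map p le_rfl).symm
  rw [hbase, sectionsBase, CommRingCat.hom_comp, CommRingCat.hom_comp]
  exact RingHom.isStandardSmooth_respectsIso.1 _
    (p.smoothLocus.ι.appIso V).symm.commRingCatIsoToRingEquiv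
    (RingHom.isStandardSmooth_respectsIso.2 _
      (Scheme.ΓSpecIso (CommRingCat.of k)).symm.commRingCatIsoToRingEquiv he)

theorem exists_etale_sections [LocallyOfFinitePresentation p] (hx : x ∈ p.smoothLocus) :
    ∃ (U : X.Opens) (n : ℕ) (g : MvPolynomial (Fin n) k →+* Sections p U), IsAffineOpen U ∧
      x ∈ U ∧ g.comp MvPolynomial.C = algebraMap k (Sections p U) ∧ g.Etale := by
  obtain ⟨U, hU, hxU, hstd⟩ := exists_isStandardSmooth_sectionsBase hx
  obtain ⟨n, g, hg, hge⟩ := hstd.exists_etale_mvPolynomial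
  exact ⟨U, n, g, hU, hxU, hg, hge⟩

variable {U : X.Opens} {n : ℕ} [Algebra (MvPolynomial (Fin n) k) (Sections p U)]
  [IsScalarTower k (MvPolynomial (Fin n) k) (Sections p U)]

theorem dim_eq_of_etale_sections [IsIntegral X] [LocallyOfFiniteType p] [CompactSpace X]
    (hU : IsAffineOpen U) [Nonempty U]
    [Algebra.Etale (MvPolynomial (Fin n) k) (Sections p U)] : dim X = n := by
  have := finiteType_sections p hU
  have hdim := ringKrullDim_sections_eq_dim p hU
  rw [ringKrullDim_eq_toNat_trdeg (k := k), trdeg_of_etale_mvPolynomial n,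
    Cardinal.toNat_natCast] at hdim
  exact_mod_cast hdim.symm

theorem topologicalKrullDim_closure_jetImage_of_etale_sections [IsAlgClosed k]
    [LocallyOfFiniteType p] (hx : IsClosed ({x} : Set X)) (hU : IsAffineOpen U) (hxU : x ∈ U)
    [Algebra.FormallyEtale (MvPolynomial (Fin n) k) (Sections p U)] (m : ℕ) :
    topologicalKrullDim (closure (jetImage p x m)) = (n * m : ℕ) := by
  obtain ⟨γ₀, hγ₀⟩ := jetImage_nonempty p hx 0
  have hγ₀x : γ₀ ∈ jetsAt p 0 x := jetImage_subset_jetsAt x 0 hγ₀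
  have hγ₀U : γ₀.LiesIn U := liesIn_of_mem_jetsAt hγ₀x hxU
  rw [topologicalKrullDim_closure_eq hx hU hxU (jetImage_subset_jetsAt x m)]
  refine (ringKrullDim_coordAlg_of_etale ((truncResidue k 0).comp (γ₀.pullbackHom hγ₀U)) _
    (fun γ b ↦ ?_) fun φ hφ hφε ↦ ?_).trans (by rw [Nat.card_fin])
  · exact Jet.truncCoeff_zero_eq_of_center_eq
      ((jetImage_subset_jetsAt x m γ.2).trans (Eq.symm hγ₀x)) _ hγ₀U b
  · have hcenter : ((Arc.ofHom hU φ hφ).jet 0).center = x := by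
      refine Jet.center_eq_of_forall_truncCoeff_eq_zero hx hU (Jet.ofHom_liesIn hU (φ 0))
        fun f hf ↦ ?_
      have hf₀ : truncCoeff k 0 (γ₀.pullbackFun hγ₀U f) = 0 := by
        rw [← hγ₀x, γ₀.center_mem_basicOpen_iff hγ₀U, not_not] at hf
        exact hf
      rw [← hf₀]
      exact (congrArg _ (Jet.pullbackFun_ofHom hU (φ 0) _ f)).trans (hφε 0 f)
    exact ⟨⟨_, Arc.ofHom hU φ hφ, mem_arcFiber_iff.mpr hcenter, rfl⟩,
      Jet.pullbackHom_ofHom hU (φ m) _⟩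

variable (p) in
theorem lambdaSeq_eq_zero_of_mem_smoothLocus [IsAlgClosed k] [IsIntegral X] [CompactSpace X]
    [LocallyOfFinitePresentation p] (hx : IsClosed ({x} : Set X)) (hxp : x ∈ p.smoothLocus) :
    lambdaSeq p x = 0 := by
  obtain ⟨U, n, g, hU, hxU, hg, hge⟩ := exists_etale_sections hxp
  algebraize [g]
  have : IsScalarTower k (MvPolynomial (Fin n) k) (Sections p U) := .of_algebraMap_eq' hg.symm
  have : Nonempty U := ⟨⟨x, hxU⟩⟩
  ext m
  rw [lambdaSeq, dim_eq_of_etale_sections (p := p) (n := n) hU, dim_eq_of_topologicalKrullDim_eq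
    (topologicalKrullDim_closure_jetImage_of_etale_sections (n := n) hx hU hxU m),
    Nat.cast_mul, mul_comm, sub_self, Pi.zero_apply]

end SmoothPoints

section ClosedPointsOfProducts

variable {k : Type u} [Field k] [IsAlgClosed k] {X Y : Scheme.{u}}
  {p : X ⟶ Spec (CommRingCat.of k)} {q : Y ⟶ Spec (CommRingCat.of k)} [LocallyOfFiniteType p]
  [LocallyOfFiniteType q]

theorem fromSpecResidueField_comp_eq_comp_pointOfClosedPoint {Z : Scheme.{u}} (f : Z ⟶ X) (z : Z)
    (hz : IsClosed ({f z} : Set X)) :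
    Z.fromSpecResidueField z ≫ f =
      (Z.fromSpecResidueField z ≫ f ≫ p) ≫ pointOfClosedPoint p (f z) hz := by
  have hX : X.fromSpecResidueField (f z) =
      (X.fromSpecResidueField (f z) ≫ p) ≫ pointOfClosedPoint p (f z) hz := by
    rw [← SpecMap_residueFieldIsoBase_inv p _ hz, pointOfClosedPoint, ← Category.assoc,
      ← Spec.map_comp, Iso.hom_inv_id, Spec.map_id, Category.id_comp]
  rw [← Category.assoc (Z.fromSpecResidueField z),
    ← Scheme.Hom.SpecMap_residueFieldMap_fromSpecResidueField]
  refine (congrArg _ hX).trans ?_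
  simp only [Category.assoc]

/-- The `k`-point of the product with given closed points as components. -/
noncomputable def pairPoint {x : X} (hx : IsClosed ({x} : Set X)) {y : Y}
    (hy : IsClosed ({y} : Set Y)) : Spec (CommRingCat.of k) ⟶ pullback p q :=
  pullback.lift (pointOfClosedPoint p x hx) (pointOfClosedPoint q y hy) (by
    rw [pointOfClosedPoint_comp, pointOfClosedPoint_comp])

theorem pairPoint_apply_closedPoint {z : ↥(pullback p q)}
    (hx : IsClosed ({pullback.fst p q z} : Set X))
    (hy : IsClosed ({pullback.snd p q z} : Set Y)) :
    pairPoint hx hy (IsLocalRing.closedPoint k) = z := by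
  have h : (pullback p q).fromSpecResidueField z =
      ((pullback p q).fromSpecResidueField z ≫ pullback.fst p q ≫ p) ≫ pairPoint hx hy := by
    apply pullback.hom_ext
    · rw [fromSpecResidueField_comp_eq_comp_pointOfClosedPoint (p := p) _ z hx, pairPoint,
        Category.assoc _ (pullback.lift _ _ _), pullback.lift_fst]
    · rw [fromSpecResidueField_comp_eq_comp_pointOfClosedPoint (p := q) _ z hy, pairPoint,
        Category.assoc _ (pullback.lift _ _ _), pullback.lift_snd, pullback.condition]
  let s : ↥(Spec ((pullback p q).residueField z)) := IsLocalRing.closedPoint _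
  have hz : ((pullback p q).fromSpecResidueField z ≫ pullback.fst p q ≫ p) s =
      IsLocalRing.closedPoint k := Subsingleton.elim (α := PrimeSpectrum k) _ _
  rw [← hz, ← Scheme.Hom.comp_apply, ← h, Scheme.fromSpecResidueField_apply]

theorem isClosed_singleton_of_fst_of_snd {z : ↥(pullback p q)}
    (hx : IsClosed ({pullback.fst p q z} : Set X))
    (hy : IsClosed ({pullback.snd p q z} : Set Y)) : IsClosed ({z} : Set ↥(pullback p q)) := by
  have h : pairPoint hx hy ≫ pullback.fst p q ≫ p = 𝟙 _ := by
    rw [pairPoint, pullback.lift_fst_assoc, pointOfClosedPoint_comp]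
  exact pairPoint_apply_closedPoint hx hy ▸
    (pointEquivClosedPoint (pullback.fst p q ≫ p) ⟨pairPoint hx hy, h⟩).2

theorem eq_of_fst_eq_of_snd_eq {z w : ↥(pullback p q)}
    (hx : IsClosed ({pullback.fst p q z} : Set X)) (hy : IsClosed ({pullback.snd p q z} : Set Y))
    (hfst : pullback.fst p q w = pullback.fst p q z)
    (hsnd : pullback.snd p q w = pullback.snd p q z) : w = z := by
  have hpair : pairPoint (p := p) (q := q) (hfst ▸ hx) (hsnd ▸ hy) = pairPoint hx hy := by
    simp only [hfst, hsnd]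
  rw [← pairPoint_apply_closedPoint hx hy, ← hpair]
  exact (pairPoint_apply_closedPoint (z := w) _ _).symm

end ClosedPointsOfProducts

section ArcsOfProducts

variable {k : Type u} [Field k] {X Y : Scheme.{u}} {p : X ⟶ Spec (CommRingCat.of k)}
  {q : Y ⟶ Spec (CommRingCat.of k)} {m : ℕ}

/-- The jet of the product with given components. -/
noncomputable def Jet.pair (γ : Jet p m) (δ : Jet q m) : Jet (pullback.fst p q ≫ p) m where
  hom := pullback.lift γ.hom δ.hom (γ.w.trans δ.w.symm)
  w := by rw [pullback.lift_fst_assoc, γ.w]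

theorem Jet.map_fst_pair (γ : Jet p m) (δ : Jet q m) :
    (γ.pair δ).map (pullback.fst p q) rfl = γ :=
  Jet.ext (pullback.lift_fst _ _ _)

theorem Jet.map_snd_pair (γ : Jet p m) (δ : Jet q m) :
    (γ.pair δ).map (pullback.snd p q) pullback.condition.symm = δ :=
  Jet.ext (pullback.lift_snd _ _ _)

theorem Jet.trunc_pair {n : ℕ} (h : n ≤ m) (γ : Jet p m) (δ : Jet q m) :
    (γ.pair δ).trunc h = (γ.trunc h).pair (δ.trunc h) := by
  ext1
  apply pullback.hom_ext
  · exact (Category.assoc _ _ _).trans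
      ((congrArg _ (pullback.lift_fst _ _ _)).trans (pullback.lift_fst _ _ _).symm)
  · exact (Category.assoc _ _ _).trans
      ((congrArg _ (pullback.lift_snd _ _ _)).trans (pullback.lift_snd _ _ _).symm)

/-- The arc of the product with given components. -/
noncomputable def Arc.pair (γ : Arc p) (δ : Arc q) : Arc (pullback.fst p q ≫ p) where
  jet m := (γ.jet m).pair (δ.jet m)
  compat n m h := by rw [Jet.trunc_pair, γ.compat, δ.compat]

theorem Jet.fst_center_pair (γ : Jet p m) (δ : Jet q m) :
    pullback.fst p q (γ.pair δ).center = γ.center := by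
  rw [← Jet.center_map (pullback.fst p q) rfl, Jet.map_fst_pair]

theorem Jet.snd_center_pair (γ : Jet p m) (δ : Jet q m) :
    pullback.snd p q (γ.pair δ).center = δ.center := by
  rw [← Jet.center_map (pullback.snd p q) pullback.condition.symm, Jet.map_snd_pair]

theorem pair_mem_jetImage [IsAlgClosed k] [LocallyOfFiniteType p] [LocallyOfFiniteType q]
    {z : ↥(pullback p q)} (hx : IsClosed ({pullback.fst p q z} : Set X))
    (hy : IsClosed ({pullback.snd p q z} : Set Y)) {γ : Jet p m} {δ : Jet q m}
    (hγ : γ ∈ jetImage p (pullback.fst p q z) m) (hδ : δ ∈ jetImage q (pullback.snd p q z) m) :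
    γ.pair δ ∈ jetImage (pullback.fst p q ≫ p) z m := by
  obtain ⟨α, hα, rfl⟩ := hγ
  obtain ⟨β, hβ, rfl⟩ := hδ
  refine ⟨α.pair β, mem_arcFiber_iff.mpr (eq_of_fst_eq_of_snd_eq hx hy ?_ ?_), rfl⟩
  · exact (Jet.fst_center_pair _ _).trans (mem_arcFiber_iff.mp hα)
  · exact (Jet.snd_center_pair _ _).trans (mem_arcFiber_iff.mp hβ)

end ArcsOfProducts

section Product

variable {k : Type u} [Field k] {X Y : Scheme.{u}} (p : X ⟶ Spec (CommRingCat.of k))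
  (q : Y ⟶ Spec (CommRingCat.of k))

/-- The pullback of sections over `U ⊆ X` to `U × V`. -/
noncomputable def sectionsFst (U : X.Opens) (V : Y.Opens) :
    Sections p U →ₐ[k]
      Sections (pullback.fst p q ≫ p) (pullback.fst p q ⁻¹ᵁ U ⊓ pullback.snd p q ⁻¹ᵁ V) :=
  sectionsPullback (pullback.fst p q) rfl inf_le_left

/-- The pullback of sections over `V ⊆ Y` to `U × V`. -/
noncomputable def sectionsSnd (U : X.Opens) (V : Y.Opens) :
    Sections q V →ₐ[k]
      Sections (pullback.fst p q ≫ p) (pullback.fst p q ⁻¹ᵁ U ⊓ pullback.snd p q ⁻¹ᵁ V) :=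
  sectionsPullback (pullback.snd p q) pullback.condition.symm inf_le_right

theorem adjoin_range_sectionsFst_union_range_sectionsSnd {U : X.Opens} {V : Y.Opens}
    (hU : IsAffineOpen U) (hV : IsAffineOpen V) :
    Algebra.adjoin k (Set.range (sectionsFst p q U V) ∪ Set.range (sectionsSnd p q U V)) = ⊤ := by
  obtain ⟨e, hfst, hsnd⟩ := exists_sections_tensorProduct_ringEquiv p q hU hV
  have htmul (a : Sections p U) (b : Sections q V) :
      e (a ⊗ₜ b) = sectionsFst p q U V a * sectionsSnd p q U V b := by
    rw [← mul_one a, ← one_mul b, ← Algebra.TensorProduct.tmul_mul_tmul, map_mul, hfst, hsnd,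
      mul_one, one_mul]
    rfl
  refine Algebra.eq_top_iff.mpr fun c ↦ ?_
  obtain ⟨t, rfl⟩ := e.surjective c
  induction t using TensorProduct.induction_on with
  | zero =>
    rw [map_zero]
    exact Subalgebra.zero_mem _
  | tmul a b =>
    rw [htmul]
    exact Subalgebra.mul_mem _ (Algebra.subset_adjoin (.inl ⟨a, rfl⟩))
      (Algebra.subset_adjoin (.inr ⟨b, rfl⟩))
  | add t t' ht ht' =>
    rw [map_add]
    exact Subalgebra.add_mem _ ht ht'

variable {p q} [IsAlgClosed k] [LocallyOfFiniteType p] [LocallyOfFiniteType q]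
  {z : ↥(pullback p q)}

theorem topologicalKrullDim_closure_jetImage_pullback
    (hx : IsClosed ({pullback.fst p q z} : Set X))
    (hy : IsClosed ({pullback.snd p q z} : Set Y)) (m : ℕ) :
    topologicalKrullDim (closure (jetImage (pullback.fst p q ≫ p) z m)) =
      topologicalKrullDim (closure (jetImage p (pullback.fst p q z) m)) +
        topologicalKrullDim (closure (jetImage q (pullback.snd p q z) m)) := by
  obtain ⟨U, hU, hxU, -⟩ := exists_isAffineOpen_mem_and_subset
    (x := pullback.fst p q z) (U := ⊤) trivial
  obtain ⟨V, hV, hyV, -⟩ := exists_isAffineOpen_mem_and_subset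
    (x := pullback.snd p q z) (U := ⊤) trivial
  have := finiteType_sections p hU
  have := finiteType_sections q hV
  have hzW : z ∈ pullback.fst p q ⁻¹ᵁ U ⊓ pullback.snd p q ⁻¹ᵁ V := ⟨hxU, hyV⟩
  rw [topologicalKrullDim_closure_eq hx hU hxU (jetImage_subset_jetsAt _ m),
    topologicalKrullDim_closure_eq hy hV hyV (jetImage_subset_jetsAt _ m),
    topologicalKrullDim_closure_eq (isClosed_singleton_of_fst_of_snd hx hy)
      (isAffineOpen_fst_inf_snd p q hU hV) hzW (jetImage_subset_jetsAt _ m)]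
  let fst (γ : jetImage (pullback.fst p q ≫ p) z m) : jetImage p (pullback.fst p q z) m :=
    ⟨γ.1.map (pullback.fst p q) rfl, map_mem_jetImage _ rfl γ.2⟩
  let snd (γ : jetImage (pullback.fst p q ≫ p) z m) : jetImage q (pullback.snd p q z) m :=
    ⟨γ.1.map (pullback.snd p q) pullback.condition.symm, map_mem_jetImage _ _ γ.2⟩
  have hpair (γ : jetImage p (pullback.fst p q z) m) (δ : jetImage q (pullback.snd p q z) m) :
      ∃ ζ, fst ζ = γ ∧ snd ζ = δ :=
    ⟨⟨γ.1.pair δ.1, pair_mem_jetImage hx hy γ.2 δ.2⟩, Subtype.ext (Jet.map_fst_pair _ _),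
      Subtype.ext (Jet.map_snd_pair _ _)⟩
  refine ringKrullDim_coordAlg_prod (g := fst) (g' := snd) hpair
    (adjoin_range_sectionsFst_union_range_sectionsSnd p q hU hV) (fun ζ a ↦ ?_) fun ζ b ↦ ?_
  · exact (ζ.1.pullbackFun_map_eq (pullback.fst p q) rfl _ _ _ a).symm
  · exact (ζ.1.pullbackFun_map_eq (pullback.snd p q) pullback.condition.symm _ _ _ b).symm

theorem lambdaSeq_pullback [CompactSpace X] [CompactSpace Y]
    (hx : IsClosed ({pullback.fst p q z} : Set X))
    (hy : IsClosed ({pullback.snd p q z} : Set Y)) :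
    lambdaSeq (pullback.fst p q ≫ p) z =
      lambdaSeq p (pullback.fst p q z) + lambdaSeq q (pullback.snd p q z) := by
  have : Nonempty X := ⟨pullback.fst p q z⟩
  have : Nonempty Y := ⟨pullback.snd p q z⟩
  ext m
  have hdim := topologicalKrullDim_closure_jetImage_pullback hx hy m
  rw [topologicalKrullDim_closure_jetImage_eq_dim hx,
    topologicalKrullDim_closure_jetImage_eq_dim hy, ← Nat.cast_add] at hdim
  rw [Pi.add_apply, lambdaSeq, lambdaSeq, lambdaSeq, dim_pullback,
    dim_eq_of_topologicalKrullDim_eq hdim]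
  push_cast
  ring

end Product

end JetArc

theorem mainTheorem6_general {k : Type u} [Field k] [IsAlgClosed k] {X Y : Scheme.{u}}
    (p : X ⟶ Spec (CommRingCat.of k)) (q : Y ⟶ Spec (CommRingCat.of k))
    [LocallyOfFiniteType p] [QuasiCompact p] [IsIntegral Y] [LocallyOfFinitePresentation q]
    [QuasiCompact q] (x : X) (hx : IsClosed ({x} : Set X)) (y : Y) (hy : IsClosed ({y} : Set Y))
    (hyq : y ∈ q.smoothLocus) (z : ↥(pullback p q)) (hzx : pullback.fst p q z = x)
    (hzy : pullback.snd p q z = y) :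
    (∀ L : ℤ, JetArc.HasLambda (pullback.fst p q ≫ p) z L ↔ JetArc.HasLambda p x L) ∧
      JetArc.lambda (pullback.fst p q ≫ p) z = JetArc.lambda p x := by
  subst hzx hzy
  have : CompactSpace X := QuasiCompact.compactSpace_of_compactSpace p
  have : CompactSpace Y := QuasiCompact.compactSpace_of_compactSpace q
  have hlambda : JetArc.lambdaSeq (pullback.fst p q ≫ p) z =
      JetArc.lambdaSeq p (pullback.fst p q z) := by
    rw [JetArc.lambdaSeq_pullback hx hy, JetArc.lambdaSeq_eq_zero_of_mem_smoothLocus q hy hyq,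
      add_zero]
  exact ⟨fun L ↦ by rw [JetArc.HasLambda, JetArc.HasLambda, hlambda],
    by rw [JetArc.lambda, JetArc.lambda, hlambda]⟩

theorem mainTheorem6 {k : Type u} [Field k] [IsAlgClosed k] {X Y : Scheme.{u}}
    (p : X ⟶ Spec (CommRingCat.of k)) (q : Y ⟶ Spec (CommRingCat.of k))
    [JetArc.IsVariety p] [JetArc.IsVariety q] [Smooth q]
    (x : X) (hx : IsClosed ({x} : Set X)) (y : Y) (hy : IsClosed ({y} : Set Y))
    (z : ↥(pullback p q)) (hzx : pullback.fst p q z = x) (hzy : pullback.snd p q z = y) :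
    (∀ L : ℤ, JetArc.HasLambda (pullback.fst p q ≫ p) z L ↔ JetArc.HasLambda p x L) ∧
      JetArc.lambda (pullback.fst p q ≫ p) z = JetArc.lambda p x := by
  obtain ⟨-, -, _, _⟩ := ‹JetArc.IsVariety p›
  obtain ⟨_, -, _, _⟩ := ‹JetArc.IsVariety q›
  exact mainTheorem6_general p q x hx y hy (q.smoothLocus_eq_top ▸ trivial) z hzx hzy
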